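/- Let $E:[0,\infty)\times\mathbb R^2\to\mathbb R^2$ be bounded and Lipschitz in $(t,x)$ (that is, the continuous representative of a field in $W^{1,\infty}$), and put $K_x:=\|D_xE\|_{L^\infty}$ (Euclidean norms on vectors, operator norm on matrices). Write $v^\perp=(-v_2,v_1)$. There is a constant $C>0$ depending only on $E$ such that the following holds for every Borel probability measure $f_0$ on $\mathbb R^2\times\mathbb R^2$ with finite first moment, and all $\varepsilon>0$, $\Delta t>0$, $n\in\mathbb N$, $t_n:=n\Delta t$. Let $f^\varepsilon=(f^\varepsilon(t))_{t\ge0}$ be a weak solution, weakly continuous in time with values in the probability measures on $\mathbb R^2\times\mathbb R^2$, of the Vlasov equation $$\varepsilon\,\partial_t f^\varepsilon+\mathrm{div}_x(v f^\varepsilon)+\mathrm{div}_v\Big(\big(E(t,x)-\tfrac1\varepsilon v^\perp\big)f^\varepsilon\Big)=0,\qquad f^\varepsilon(0)=f_0,$$ and let $\rho^\varepsilon(t,\cdot)=\int_{\mathbb R^2} f^\varepsilon(t,\cdot,\mathrm dv)$ be its charge density, i.e. the $x$-marginal of $f^\varepsilon(t)$. Let $X^{\Delta t}_\varepsilon(t_n,0,x,v):=x^n$,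 where $(x^n,v^n)_{n\ge0}$ is the unique solution of the semi-implicit scheme $$\frac{x^{n+1}-x^n}{\Delta t}=\frac{v^{n+1}}{\varepsilon},\qquad \varepsilon\,\frac{v^{n+1}-v^n}{\Delta t}=E(t_n,x^n)-\frac{(v^{n+1})^\perp}{\varepsilon},\qquad (x^0,v^0)=(x,v),$$ and let $\rho^\varepsilon_{\Delta t}(t_n,\cdot)$ be the push-forward of $f_0$ by $(x,v)\mapsto X^{\Delta t}_\varepsilon(t_n,0,x,v)$. Then $$\|\rho^\varepsilon_{\Delta t}(t_n,\cdot)-\rho^\varepsilon(t_n,\cdot)\|_{\dot W^{-1,1}}\le C\,\min\Big(\frac{\Delta t}{\varepsilon^3}(1+\varepsilon^2),\ \Delta t+\varepsilon\Big)\,e^{2K_xt_n}\,(1+t_n^2)\int_{\mathbb R^2\times\mathbb R^2}(1+\varepsilon+\|v\|)\,\mathrm df_0(x,v),$$ where $\|\mu\|_{\dot W^{-1,1}}:=\sup\big\{\big|\int\varphi\,\mathrm d\mu\big| : \varphi\in W^{1,\infty}(\mathbb R^2),\ \|\nabla\varphi\|_{L^\infty}\le1\big\}$ is the canonical seminorm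 on $W^{-1,1}=(W^{1,\infty})^*$. -/

import Mathlib

open MeasureTheory
open scoped ContDiff ENNReal NNReal

noncomputable section

namespace GyroVlasov

/-- The plane `ℝ²` with its Euclidean norm. -/
abbrev Plane : Type := EuclideanSpace ℝ (Fin 2)

/-- The phase space of pairs `(x, v)`. -/
abbrev Phase : Type := Plane × Plane

/-- The rotated vector `v^⊥ = J v = (-v₂, v₁)`. -/
def perp (v : Plane) : Plane := !₂[-(v 1), v 0]

/-- `E ∈ W^{1,∞}` for a field `E(t, x)` on `[0, ∞) × ℝ²`, represented by its continuous
representative: `E` is bounded and Lipschitz in `(t, x)`. Values at negative times are irrelevant. -/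
def IsLipschitzField (E : ℝ → Plane → Plane) : Prop :=
  (∃ M : ℝ, ∀ t : ℝ, 0 ≤ t → ∀ x : Plane, ‖E t x‖ ≤ M) ∧
  ∃ L : ℝ≥0, LipschitzOnWith L (fun q : ℝ × Plane => E q.1 q.2) (Set.Ici 0 ×ˢ Set.univ)

/-- `K_x = ‖D_x E‖_{L^∞([0, ∞) × ℝ²)}`, with the operator norm on `D_x E(t, x)`. For a Lipschitz
field the derivative exists almost everywhere, and the essential supremum is finite. -/
def lipX (E : ℝ → Plane → Plane) : ℝ :=
  (essSup (fun q : ℝ × Plane => ‖fderiv ℝ (E q.1) q.2‖ₑ)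
    (volume.restrict (Set.Ici (0 : ℝ) ×ˢ (Set.univ : Set Plane)))).toReal

/-- The test functions of the `W^{-1,1}` seminorm on the plane: real functions `φ ∈ W^{1,∞}(ℝ²)`,
that is, bounded Lipschitz functions, with `‖∇φ‖_{L^∞} ≤ 1`. -/
def IsTestFunction (φ : Plane → ℝ) : Prop :=
  (∃ M : ℝ, ∀ x, |φ x| ≤ M) ∧ (∃ L : ℝ≥0, LipschitzWith L φ) ∧
  essSup (fun x => ‖fderiv ℝ φ x‖ₑ) volume ≤ 1

/-- The seminorm `‖μ - ν‖_{W^{-1,1}}`, the supremum of `|∫ φ d(μ - ν)|` over the functions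
`φ ∈ W^{1,∞}(ℝ²)` with `‖∇φ‖_{L^∞} ≤ 1`, for finite measures `μ` and `ν`. -/
def wNegDist (μ ν : Measure Plane) : ℝ≥0∞ :=
  ⨆ φ : {φ : Plane → ℝ // IsTestFunction φ},
    ENNReal.ofReal |(∫ x, φ.1 x ∂μ) - ∫ x, φ.1 x ∂ν|

/-- The curve `t ↦ f t` (`t ≥ 0`) of probability measures on phase space, continuous for the weak
convergence of measures, is a weak solution with initial datum `f₀` of the Vlasov equation
`ε ∂_t f + div_x (v f) + div_v ((E - v^⊥ / ε) f) = 0`.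
In the weak formulation,
`fderiv ℝ φ (x, v) (v, E - v^⊥ / ε) = v · ∇_x φ + (E - v^⊥ / ε) · ∇_v φ`. -/
def IsVlasovSolution (ε : ℝ) (E : ℝ → Plane → Plane) (f₀ : ProbabilityMeasure Phase)
    (f : ℝ → ProbabilityMeasure Phase) : Prop :=
  f 0 = f₀ ∧ ContinuousOn f (Set.Ici 0) ∧
  ∀ φ : Phase → ℝ, ContDiff ℝ ∞ φ → HasCompactSupport φ → ∀ t : ℝ, 0 ≤ t →
    ε * ((∫ p, φ p ∂(f t : Measure Phase)) - ∫ p, φ p ∂(f₀ : Measure Phase)) =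
      ∫ s in (0 : ℝ)..t,
        ∫ p, fderiv ℝ φ p (p.2, E s p.1 - ε⁻¹ • perp p.2) ∂(f s : Measure Phase)

/-- The charge density of a phase-space measure, `ρ = ∫ f dv`: its marginal in `x`. -/
def chargeDensity (f : Measure Phase) : Measure Plane := f.map Prod.fst

/-- One step from `p = (xⁿ, vⁿ)` at time `t = t_n` to `q = (xⁿ⁺¹, vⁿ⁺¹)` of the semi-implicit
first-order scheme. -/
def IsSchemeStep (ε Δt : ℝ) (E : ℝ → Plane → Plane) (t : ℝ) (p q : Phase) : Prop :=
  Δt⁻¹ • (q.1 - p.1) = ε⁻¹ • q.2 ∧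
  ε • Δt⁻¹ • (q.2 - p.2) = E t p.1 - ε⁻¹ • perp q.2

/-- The velocity update of the scheme: the solution `w` of
`w + λ w^⊥ = vⁿ + (Δt / ε) E(t_n, xⁿ)`, with `λ = Δt / ε²`. -/
def velocityUpdate (ε Δt : ℝ) (E : ℝ → Plane → Plane) (t : ℝ) (p : Phase) : Plane :=
  (1 + (Δt / ε ^ 2) ^ 2)⁻¹ •
    ((p.2 + (Δt / ε) • E t p.1) - (Δt / ε ^ 2) • perp (p.2 + (Δt / ε) • E t p.1))

/-- One step of the scheme, solved for the new position and velocity. -/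
def schemeStep (ε Δt : ℝ) (E : ℝ → Plane → Plane) (t : ℝ) (p : Phase) : Phase :=
  (p.1 + (Δt / ε) • velocityUpdate ε Δt E t p, velocityUpdate ε Δt E t p)

/-- The implicit equations of the scheme have exactly one solution, namely `schemeStep`. -/
theorem isSchemeStep_iff {ε Δt : ℝ} (hε : 0 < ε) (hΔt : 0 < Δt) (E : ℝ → Plane → Plane) (t : ℝ)
    (p q : Phase) : IsSchemeStep ε Δt E t p q ↔ q = schemeStep ε Δt E t p := by
  have hl : (1 + (Δt / ε ^ 2) ^ 2) ≠ 0 := by positivity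
  have he := hε.ne'
  have hd := hΔt.ne'
  obtain ⟨x, v⟩ := p
  obtain ⟨y, w⟩ := q
  simp only [IsSchemeStep, schemeStep, velocityUpdate, Prod.mk.injEq]
  constructor
  · rintro ⟨h1, h2⟩
    have h2' : w = (1 + (Δt / ε ^ 2) ^ 2)⁻¹ •
        ((v + (Δt / ε) • E t x) - (Δt / ε ^ 2) • perp (v + (Δt / ε) • E t x)) := by
      have a0 := congrArg (fun u : Plane => u 0) h2
      have a1 := congrArg (fun u : Plane => u 1) h2
      simp [perp] at a0 a1
      field_simp at a0 a1
      ext i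
      fin_cases i
      · simp [perp]
        field_simp
        linear_combination (ε ^ 2) * a0 + Δt * a1
      · simp [perp]
        field_simp
        linear_combination (ε ^ 2) * a1 - Δt * a0
    refine ⟨?_, h2'⟩
    rw [← h2']
    ext i
    have a := congrArg (fun u : Plane => u i) h1
    simp at a
    field_simp at a
    simp
    field_simp
    linear_combination a
  · rintro ⟨h1, h2⟩
    rw [← h2] at h1
    constructor
    · rw [h1]
      ext i
      simp
      field_simp
    · rw [h2]
      ext i
      fin_cases i
      · simp [perp]
        field_simp
        ring
      · simp [perp]
        field_simp
        ring

/-- The discrete flow `(X_ε^Δt, V_ε^Δt)(t_n, 0, x, v)` of the scheme, with `t_n = n Δt`. -/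
def discreteFlow (ε Δt : ℝ) (E : ℝ → Plane → Plane) : ℕ → Phase → Phase
  | 0, p => p
  | n + 1, p => schemeStep ε Δt E (n * Δt) (discreteFlow ε Δt E n p)

/-- The discrete charge density at time `t_n`, the push-forward of `f₀` by the position component
`X_ε^Δt(t_n, 0, ·, ·)` of the discrete flow. -/
def discreteDensity (ε Δt : ℝ) (E : ℝ → Plane → Plane) (f₀ : Measure Phase) (n : ℕ) :
    Measure Plane :=
  f₀.map (fun p => (discreteFlow ε Δt E n p).1)

end GyroVlasov

end

/-!
The scheme with step `h` is compared with its refinements of step `h / m`, with a bound on the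
difference of the orbits that does not depend on `m`. The stiff rate `h (1 + ε²) / ε³` comes from a
stability estimate in the variables of guiding center `x - ε v^⊥` and rescaled velocity `ε v`, in
which the rotation is harmless; the uniform rate `h + ε` comes from the guiding center, which
moves by `-h E^⊥` in each step, while `ε v` stays of order `ε`.

The laws of the refinements converge weakly to any weak solution `f`. This is a duality argument
without recourse to uniqueness of the continuous problem: a compactly supported Lipschitz test
function is transported backwards by the scheme, each step is mollified and inserted into the weak
formulation, and the consistency error and the mollification error add up to something small.
Letting `m → ∞`, lower semicontinuity of the seminorm under weak convergence concludes.
-/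

namespace GyroVlasov

section LipschitzConstant

theorem ae_ae_add_smul {V : Type*} [AddCommGroup V] [Module ℝ V] [MeasurableSpace V]
    [MeasurableAdd₂ V] [MeasurableSMul ℝ V] {μ : Measure V} [SFinite μ] [μ.IsAddRightInvariant]
    {p : V → Prop} (hp : ∀ᵐ x ∂μ, p x) (h : V) : ∀ᵐ z ∂μ, ∀ᵐ s : ℝ, p (z + s • h) := by
  obtain ⟨G, hsub, hmeas, hnull⟩ := exists_measurable_superset_of_null hp
  have hline : ∀ᵐ z ∂μ, ∀ᵐ s : ℝ, z + s • h ∉ G := by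
    have hGline : MeasurableSet {q : V × ℝ | q.1 + q.2 • h ∉ G} :=
      (hmeas.preimage (measurable_fst.add (measurable_snd.smul_const h))).compl
    rw [Measure.ae_ae_comm hGline]
    refine Filter.Eventually.of_forall fun s => ?_
    have hshift := measure_preimage_add_right μ (s • h) G
    rw [hnull] at hshift
    exact measure_eq_zero_iff_ae_notMem.mp hshift
  filter_upwards [hline] with z hz
  filter_upwards [hz] with s hs
  exact not_not.mp fun hbad => hs (hsub hbad)

theorem lipschitzWith_of_ae_nnnorm_deriv_le {g : ℝ → ℝ} {C K : ℝ≥0} (hg : LipschitzWith C g)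
    (hK : ∀ᵐ s, ‖deriv g s‖₊ ≤ K) : LipschitzWith K g := by
  refine LipschitzWith.of_dist_le_mul fun a b => ?_
  have hftc : ∫ s in b..a, deriv g s = g a - g b :=
    hg.lipschitzOnWith.absolutelyContinuousOnInterval.integral_deriv_eq_sub
  rw [Real.dist_eq, Real.dist_eq, ← hftc, ← Real.norm_eq_abs]
  refine intervalIntegral.norm_integral_le_of_norm_le_const_ae ?_
  filter_upwards [hK] with s hs _
  exact hs

variable {V : Type*} [NormedAddCommGroup V] [NormedSpace ℝ V] [FiniteDimensional ℝ V]
  [MeasurableSpace V] [BorelSpace V] {μ : Measure V} [μ.IsAddHaarMeasure]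

theorem lipschitzWith_of_ae_nnnorm_fderiv_le_real {f : V → ℝ} {C K : ℝ≥0}
    (hf : LipschitzWith C f) (hK : ∀ᵐ x ∂μ, ‖fderiv ℝ f x‖₊ ≤ K) : LipschitzWith K f := by
  refine LipschitzWith.of_dist_le_mul fun x y => ?_
  have hae : ∀ᵐ z ∂μ, |f (z + (x - y)) - f z| ≤ K * ‖x - y‖ := by
    filter_upwards [ae_ae_add_smul (hf.ae_differentiableAt.and hK) (x - y)] with z hz
    have hlip : LipschitzWith (C * ‖x - y‖₊) fun s : ℝ => f (z + s • (x - y)) :=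
      hf.comp (LipschitzWith.of_dist_le_mul fun s t => by
        rw [dist_add_left, dist_eq_norm, ← sub_smul, norm_smul, mul_comm, dist_eq_norm, coe_nnnorm])
    have hderiv : ∀ᵐ s : ℝ, ‖deriv (fun s : ℝ => f (z + s • (x - y))) s‖₊ ≤ K * ‖x - y‖₊ := by
      filter_upwards [hz] with s hs
      have hline : HasDerivAt (fun s : ℝ => z + s • (x - y)) (x - y) s := by
        simpa using ((hasDerivAt_id s).smul_const (x - y)).const_add z
      have hcomp : HasDerivAt (fun s : ℝ => f (z + s • (x - y)))
          (fderiv ℝ f (z + s • (x - y)) (x - y)) s := hs.1.hasFDerivAt.comp_hasDerivAt s hline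
      rw [hcomp.deriv]
      exact (ContinuousLinearMap.le_opNNNorm _ _).trans (by gcongr; exact hs.2)
    simpa [Real.dist_eq] using
      (lipschitzWith_of_ae_nnnorm_deriv_le hlip hderiv).dist_le_mul 1 0
  have hclosed : IsClosed {z : V | |f (z + (x - y)) - f z| ≤ K * ‖x - y‖} := by
    have := hf.continuous
    exact isClosed_le (by fun_prop) continuous_const
  have hall := hclosed.closure_eq ▸ (Measure.dense_of_ae hae).closure_eq
  simpa [Real.dist_eq, dist_eq_norm] using hall.ge (Set.mem_univ y)

theorem lipschitzWith_of_ae_nnnorm_fderiv_le {F : Type*} [NormedAddCommGroup F]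
    [NormedSpace ℝ F] [FiniteDimensional ℝ F] {f : V → F} {C K : ℝ≥0} (hf : LipschitzWith C f)
    (hK : ∀ᵐ x ∂μ, ‖fderiv ℝ f x‖₊ ≤ K) : LipschitzWith K f := by
  refine LipschitzWith.of_dist_le_mul fun x y => ?_
  obtain ⟨g, hg, hgv⟩ := exists_dual_vector'' ℝ (f x - f y)
  have hgf : ∀ᵐ z ∂μ, ‖fderiv ℝ (g ∘ f) z‖₊ ≤ K := by
    filter_upwards [hK, hf.ae_differentiableAt] with z hz hd
    rw [(g.hasFDerivAt.comp z hd.hasFDerivAt).fderiv]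
    exact (g.opNNNorm_comp_le _).trans
      ((mul_le_of_le_one_left zero_le (show ‖g‖₊ ≤ 1 from hg)).trans hz)
  have hlip := lipschitzWith_of_ae_nnnorm_fderiv_le_real (g.lipschitz.comp hf) hgf
  calc dist (f x) (f y) = dist (g (f x)) (g (f y)) := by
        rw [dist_eq_norm, dist_eq_norm, ← map_sub, hgv]; simp
    _ ≤ K * dist x y := hlip.dist_le_mul x y

end LipschitzConstant

theorem IsTestFunction.lipschitzWith {φ : Plane → ℝ} (hφ : IsTestFunction φ) :
    LipschitzWith 1 φ := by
  obtain ⟨-, ⟨L, hL⟩, hsup⟩ := hφ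
  refine lipschitzWith_of_ae_nnnorm_fderiv_le (μ := volume) hL ?_
  filter_upwards [ENNReal.ae_le_essSup fun z : Plane => ‖fderiv ℝ φ z‖ₑ] with z hz
  exact ENNReal.coe_le_coe.mp (hz.trans hsup)

section Field

theorem lipschitzWith_slice {α β γ : Type*} [PseudoEMetricSpace α] [PseudoEMetricSpace β]
    [PseudoEMetricSpace γ] {f : α → β → γ} {L : ℝ≥0} {s : Set α}
    (hf : LipschitzOnWith L (fun q : α × β => f q.1 q.2) (s ×ˢ Set.univ)) {a : α} (ha : a ∈ s) :
    LipschitzWith L (f a) := by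
  have hslice := hf.comp (LipschitzWith.prodMk_left a).lipschitzOnWith
    fun b hb => Set.mk_mem_prod ha hb
  rwa [mul_one, lipschitzOnWith_univ] at hslice

variable {E : ℝ → Plane → Plane}

theorem IsLipschitzField.ae_nnnorm_fderiv_le_lipX (hE : IsLipschitzField E) :
    ∀ᵐ t ∂(volume.restrict (Set.Ici (0 : ℝ))), ∀ᵐ x, ‖fderiv ℝ (E t) x‖₊ ≤ (lipX E).toNNReal := by
  obtain ⟨-, L, hL⟩ := hE
  set μ := (volume : Measure (ℝ × Plane)).restrict (Set.Ici 0 ×ˢ Set.univ) with hμ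
  have hprod : (volume.restrict (Set.Ici (0 : ℝ))).prod (volume : Measure Plane) = μ := by
    rw [hμ, Measure.volume_eq_prod, ← Measure.prod_restrict, Measure.restrict_univ]
  have hfin : essSup (fun q : ℝ × Plane => ‖fderiv ℝ (E q.1) q.2‖ₑ) μ ≤ L := by
    refine essSup_le_of_ae_le _ ?_
    filter_upwards [ae_restrict_mem (measurableSet_Ici.prod MeasurableSet.univ)] with q hq
    exact ENNReal.coe_le_coe.mpr (norm_fderiv_le_of_lipschitz ℝ (lipschitzWith_slice hL hq.1))
  refine Measure.ae_ae_of_ae_prod (hprod ▸ ?_ : ∀ᵐ q ∂((volume.restrict (Set.Ici 0)).prod volume),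
    ‖fderiv ℝ (E q.1) q.2‖₊ ≤ (lipX E).toNNReal)
  filter_upwards [ENNReal.ae_le_essSup (μ := μ) fun q => ‖fderiv ℝ (E q.1) q.2‖ₑ] with q hq
  exact ENNReal.coe_le_coe.mp (hq.trans_eq (ENNReal.ofReal_toReal
    (ne_top_of_le_ne_top ENNReal.coe_ne_top hfin)).symm)

theorem IsLipschitzField.lipschitzWith_lipX (hE : IsLipschitzField E) {t : ℝ} (ht : 0 ≤ t) :
    LipschitzWith (lipX E).toNNReal (E t) := by
  obtain ⟨L, hL⟩ := hE.2
  have hcont : ∀ z, ContinuousOn (fun s => E s z) (Set.Ici 0) := fun z =>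
    hL.continuousOn.comp (f := fun s : ℝ => (s, z)) (by fun_prop) fun s hs => ⟨hs, trivial⟩
  refine LipschitzWith.of_dist_le_mul fun x y => ?_
  have hae : (fun s => max (dist (E s x) (E s y)) ((lipX E).toNNReal * dist x y))
      =ᵐ[volume.restrict (Set.Ici 0)] fun _ => (lipX E).toNNReal * dist x y := by
    filter_upwards [hE.ae_nnnorm_fderiv_le_lipX, ae_restrict_mem measurableSet_Ici] with s hs hs0
    exact max_eq_right
      ((lipschitzWith_of_ae_nnnorm_fderiv_le (lipschitzWith_slice hL hs0) hs).dist_le_mul x y)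
  exact max_eq_right_iff.mp (Measure.eqOn_of_ae_eq hae
    ((continuous_dist.comp_continuousOn ((hcont x).prodMk (hcont y))).sup continuousOn_const)
    continuousOn_const (by rw [interior_Ici, closure_Ioi]) ht)

end Field

/-- Quantitative form of `IsLipschitzField`: on `t ≥ 0` the field is `K`-Lipschitz in space,
`L`-Lipschitz in time and bounded by `M`. -/
structure FieldBounds (E : ℝ → Plane → Plane) (K L M : ℝ≥0) : Prop where
  space : ∀ t, 0 ≤ t → LipschitzWith K (E t)
  time : ∀ x, LipschitzOnWith L (fun t => E t x) (Set.Ici 0)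
  size : ∀ t, 0 ≤ t → ∀ x, ‖E t x‖ ≤ M

theorem FieldBounds.norm_sub_le {E : ℝ → Plane → Plane} {K L M : ℝ≥0} (hb : FieldBounds E K L M)
    {s t : ℝ} (hs : 0 ≤ s) (ht : 0 ≤ t) (x y : Plane) :
    ‖E s x - E t y‖ ≤ L * |s - t| + K * ‖x - y‖ :=
  (norm_sub_le_norm_sub_add_norm_sub _ (E t x) _).trans
    (add_le_add ((hb.time x).norm_sub_le hs ht) ((hb.space t ht).norm_sub_le x y))

theorem IsLipschitzField.exists_fieldBounds {E : ℝ → Plane → Plane} (hE : IsLipschitzField E) :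
    ∃ L M, FieldBounds E (lipX E).toNNReal L M := by
  obtain ⟨M, hM⟩ := hE.1
  obtain ⟨L, hL⟩ := hE.2
  refine ⟨L, M.toNNReal, fun t ht => hE.lipschitzWith_lipX ht, fun x => ?_,
    fun t ht x => (hM t ht x).trans (Real.le_coe_toNNReal M)⟩
  have hslice := hL.comp (LipschitzWith.prodMk_right (α := ℝ) x).lipschitzOnWith
    fun t (ht : t ∈ Set.Ici (0 : ℝ)) => Set.mk_mem_prod ht (Set.mem_univ x)
  rwa [mul_one] at hslice

section Perp

theorem perp_add (v w : Plane) : perp (v + w) = perp v + perp w := by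
  ext i; fin_cases i <;> simp [perp]; ring

theorem perp_smul (c : ℝ) (v : Plane) : perp (c • v) = c • perp v := by
  ext i; fin_cases i <;> simp [perp]

theorem perp_sub (v w : Plane) : perp (v - w) = perp v - perp w := by
  ext i; fin_cases i <;> simp [perp]; ring

theorem perp_perp (v : Plane) : perp (perp v) = -v := by
  ext i; fin_cases i <;> simp [perp]

theorem norm_perp (v : Plane) : ‖perp v‖ = ‖v‖ := by
  simp [EuclideanSpace.norm_eq, perp, add_comm]

theorem norm_smul_perp {c : ℝ} (hc : 0 ≤ c) (v : Plane) : ‖c • perp v‖ = c * ‖v‖ := by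
  rw [norm_smul_of_nonneg hc, norm_perp]

theorem norm_le_norm_add_smul_perp (c : ℝ) (v : Plane) : ‖v‖ ≤ ‖v + c • perp v‖ := by
  have hsq : ‖v + c • perp v‖ ^ 2 = (1 + c ^ 2) * ‖v‖ ^ 2 := by
    simp [EuclideanSpace.norm_sq_eq, perp]
    ring
  refine le_of_sq_le_sq ?_ (norm_nonneg _)
  rw [hsq]
  exact le_mul_of_one_le_left (sq_nonneg _) (le_add_of_nonneg_right (sq_nonneg c))

end Perp

section Recursion

variable {F : Type*} [SeminormedAddCommGroup F] [NormedSpace ℝ F] {u : ℕ → F} {a m : ℕ} {c : ℝ}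

theorem norm_add_sub_smul_le {d : F} (h : ∀ i < m, ‖u (a + i + 1) - u (a + i) - d‖ ≤ c) :
    ‖u (a + m) - u a - (m : ℝ) • d‖ ≤ m * c := by
  induction m with
  | zero => simp
  | succ m ih =>
    calc ‖u (a + (m + 1)) - u a - ((m + 1 : ℕ) : ℝ) • d‖
        = ‖(u (a + m) - u a - (m : ℝ) • d) + (u (a + m + 1) - u (a + m) - d)‖ := by
          congr 1; push_cast; rw [← add_assoc]; module
      _ ≤ m * c + c := (norm_add_le _ _).trans
          (add_le_add (ih fun i hi => h i (by omega)) (h m (by omega)))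
      _ = _ := by push_cast; ring

theorem norm_add_sub_le (h : ∀ i < m, ‖u (a + i + 1) - u (a + i)‖ ≤ c) :
    ‖u (a + m) - u a‖ ≤ m * c := by
  simpa using norm_add_sub_smul_le (d := (0 : F)) (by simpa using h)

theorem discrete_gronwall {a : ℕ → ℝ} {N : ℕ} {c β : ℝ} (hc : 0 ≤ c) (hβ : 0 ≤ β)
    (h0 : 0 ≤ a 0) (h : ∀ n < N, a (n + 1) ≤ (1 + c) * a n + Real.exp (c * (n + 1)) * β) :
    a N ≤ Real.exp (c * N) * (a 0 + N * β) := by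
  induction N with
  | zero => simp
  | succ N ih =>
    calc a (N + 1) ≤ (1 + c) * a N + Real.exp (c * (N + 1)) * β := h N (by omega)
      _ ≤ (1 + c) * (Real.exp (c * N) * (a 0 + N * β)) + Real.exp (c * (N + 1)) * β := by
        gcongr
        exact ih fun n hn => h n (by omega)
      _ ≤ Real.exp c * (Real.exp (c * N) * (a 0 + N * β)) + Real.exp (c * (N + 1)) * β := by
        gcongr
        linarith [Real.add_one_le_exp c]
      _ = _ := by push_cast; rw [mul_add c, Real.exp_add]; ring_nf

end Recursion

/-- The sequence `(x n, v n)` is an orbit of the semi-implicit scheme with step `h` started at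
time `0`. -/
structure IsOrbit (ε h : ℝ) (E : ℝ → Plane → Plane) (x v : ℕ → Plane) : Prop where
  pos : ∀ n, x (n + 1) = x n + (h / ε) • v (n + 1)
  vel : ∀ n : ℕ, v (n + 1) + (h / ε ^ 2) • perp (v (n + 1)) = v n + (h / ε) • E (n * h) (x n)

theorem velocityUpdate_add_smul_perp (ε h : ℝ) (E : ℝ → Plane → Plane) (t : ℝ) (p : Phase) :
    velocityUpdate ε h E t p + (h / ε ^ 2) • perp (velocityUpdate ε h E t p) =
      p.2 + (h / ε) • E t p.1 := by
  have hne : 1 + (h / ε ^ 2) ^ 2 ≠ 0 := by positivity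
  simp only [velocityUpdate]
  generalize p.2 + (h / ε) • E t p.1 = u
  generalize h / ε ^ 2 = c at *
  rw [perp_smul, perp_sub, perp_smul, perp_perp, smul_comm c, ← smul_add,
    show u - c • perp u + c • (perp u - c • -u) = (1 + c ^ 2) • u by module,
    inv_smul_smul₀ hne]

theorem isOrbit_discreteFlow (ε h : ℝ) (E : ℝ → Plane → Plane) (p : Phase) :
    IsOrbit ε h E (fun n => (discreteFlow ε h E n p).1) (fun n => (discreteFlow ε h E n p).2) :=
  ⟨fun _ => rfl, fun _ => velocityUpdate_add_smul_perp _ _ _ _ _⟩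

/-- The guiding center `x - ε v^⊥` of a particle, which moves slowly as `ε → 0`. -/
noncomputable def guidingCenter (ε : ℝ) (x v : Plane) : Plane := x - ε • perp v

/-- The distance between the states `(x, v)` and `(y, w)` in the variables of guiding center and
rescaled velocity, for which the scheme is stable at rate `2 K` whatever `ε`. -/
noncomputable def gyroDist (ε : ℝ) (x v y w : Plane) : ℝ :=
  ‖guidingCenter ε x v - guidingCenter ε y w‖ + ε * ‖v - w‖

theorem norm_sub_le_gyroDist {ε : ℝ} (hε : 0 ≤ ε) (x v y w : Plane) :
    ‖x - y‖ ≤ gyroDist ε x v y w := by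
  rw [gyroDist, ← norm_smul_perp hε]
  calc ‖x - y‖ = ‖(guidingCenter ε x v - guidingCenter ε y w) + ε • perp (v - w)‖ := by
        rw [perp_sub, guidingCenter, guidingCenter]; congr 1; module
    _ ≤ _ := norm_add_le _ _

/-- The growth of the velocity along the scheme up to time `T`, apart from a factor
`exp (K T)`, when the initial velocity has norm `r`. -/
def velocityBound (K L M : ℝ≥0) (ε T r : ℝ) : ℝ := r + 2 * ε * M + T * (ε * (L + K * M))

section Orbit

variable {E : ℝ → Plane → Plane} {K L M : ℝ≥0} {ε h : ℝ} {x v : ℕ → Plane}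

theorem IsOrbit.norm_succ_add_smul_perp_le (ho : IsOrbit ε h E x v) (hε : 0 < ε) (n : ℕ) :
    ‖v (n + 1) + ε • perp (E (n * h) (x n))‖ ≤ ‖v n + ε • perp (E (n * h) (x n))‖ := by
  have hlam : ε * (h / ε ^ 2) = h / ε := by field_simp
  have hv := ho.vel n
  rw [← hlam] at hv
  refine (norm_le_norm_add_smul_perp (h / ε ^ 2) _).trans_eq (congrArg norm ?_)
  rw [perp_add, perp_smul, perp_perp]
  linear_combination (norm := module) hv

theorem IsOrbit.norm_pos_succ_sub (ho : IsOrbit ε h E x v) (hε : 0 < ε) (hh : 0 ≤ h) (n : ℕ) :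
    ‖x (n + 1) - x n‖ = h / ε * ‖v (n + 1)‖ := by
  rw [ho.pos, add_sub_cancel_left, norm_smul_of_nonneg (by positivity)]

theorem IsOrbit.norm_corrected_velocity_succ_le (ho : IsOrbit ε h E x v) (hb : FieldBounds E K L M)
    (hε : 0 < ε) (hh : 0 ≤ h) (n : ℕ) :
    ‖v (n + 1) + ε • perp (E ((n + 1 : ℕ) * h) (x (n + 1)))‖ ≤
      (1 + K * h) * ‖v n + ε • perp (E (n * h) (x n))‖ + h * (ε * (L + K * M)) := by
  set e := E (n * h) (x n)
  set e' := E ((n + 1 : ℕ) * h) (x (n + 1))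
  have hdecay : ‖v (n + 1) + ε • perp e‖ ≤ ‖v n + ε • perp e‖ :=
    ho.norm_succ_add_smul_perp_le hε n
  have hvel : ‖v (n + 1)‖ ≤ ‖v n + ε • perp e‖ + ε * M := by
    calc ‖v (n + 1)‖ = ‖(v (n + 1) + ε • perp e) - ε • perp e‖ := by rw [add_sub_cancel_right]
      _ ≤ ‖v (n + 1) + ε • perp e‖ + ε * ‖e‖ := norm_smul_perp hε.le e ▸ norm_sub_le _ _
      _ ≤ _ := by gcongr; exact hb.size _ (by positivity) _
  have hfield : ‖e' - e‖ ≤ L * h + K * (h / ε * ‖v (n + 1)‖) := by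
    refine (hb.norm_sub_le (by positivity) (by positivity) _ _).trans_eq ?_
    rw [ho.norm_pos_succ_sub hε hh, show ((n + 1 : ℕ) : ℝ) * h - n * h = h by push_cast; ring,
      abs_of_nonneg hh]
  calc ‖v (n + 1) + ε • perp e'‖ = ‖(v (n + 1) + ε • perp e) + ε • perp (e' - e)‖ := by
        rw [perp_sub]; congr 1; module
    _ ≤ ‖v (n + 1) + ε • perp e‖ + ε * ‖e' - e‖ := norm_smul_perp hε.le (e' - e) ▸ norm_add_le _ _
    _ ≤ ‖v n + ε • perp e‖ + ε * (L * h + K * (h / ε * (‖v n + ε • perp e‖ + ε * M))) := by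
      gcongr
      exact hfield.trans (by gcongr)
    _ = _ := by field_simp; ring

theorem IsOrbit.norm_corrected_velocity_le (ho : IsOrbit ε h E x v) (hb : FieldBounds E K L M)
    (hε : 0 < ε) (hh : 0 ≤ h) (n : ℕ) :
    ‖v n + ε • perp (E (n * h) (x n))‖ ≤
      Real.exp (K * (n * h)) * (‖v 0‖ + ε * M + n * h * (ε * (L + K * M))) := by
  have hinit : ‖v 0 + ε • perp (E ((0 : ℕ) * h) (x 0))‖ ≤ ‖v 0‖ + ε * M := by
    refine (norm_add_le _ _).trans ?_
    rw [norm_smul_perp hε.le]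
    gcongr
    exact hb.size _ (by simp) _
  calc _ ≤ Real.exp (K * h * n) * (‖v 0 + ε • perp (E ((0 : ℕ) * h) (x 0))‖ +
        n * (h * (ε * (L + K * M)))) := by
        refine discrete_gronwall (a := fun n => ‖v n + ε • perp (E (n * h) (x n))‖)
          (by positivity) (by positivity) (norm_nonneg _) fun k _ =>
          (ho.norm_corrected_velocity_succ_le hb hε hh k).trans (add_le_add le_rfl ?_)
        exact le_mul_of_one_le_left (by positivity) (Real.one_le_exp (by positivity))
    _ ≤ Real.exp (K * h * n) * (‖v 0‖ + ε * M + n * (h * (ε * (L + K * M)))) := by gcongr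
    _ = _ := by ring_nf

theorem IsOrbit.norm_velocity_le (ho : IsOrbit ε h E x v) (hb : FieldBounds E K L M)
    (hε : 0 < ε) (hh : 0 ≤ h) {n : ℕ} {S T : ℝ} (hn : n * h ≤ S) (hST : S ≤ T) :
    ‖v n‖ ≤ Real.exp (K * S) * velocityBound K L M ε T ‖v 0‖ := by
  have hnT := hn.trans hST
  have hfield : ‖ε • perp (E (n * h) (x n))‖ ≤ Real.exp (K * (n * h)) * (ε * M) := by
    rw [norm_smul_perp hε.le]
    refine (mul_le_mul_of_nonneg_left (hb.size _ (by positivity) _) hε.le).trans ?_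
    exact le_mul_of_one_le_left (by positivity) (Real.one_le_exp (by positivity))
  calc ‖v n‖ = ‖(v n + ε • perp (E (n * h) (x n))) - ε • perp (E (n * h) (x n))‖ := by
        rw [add_sub_cancel_right]
    _ ≤ Real.exp (K * (n * h)) * (‖v 0‖ + ε * M + n * h * (ε * (L + K * M))) +
        Real.exp (K * (n * h)) * (ε * M) :=
      (norm_sub_le _ _).trans (add_le_add (ho.norm_corrected_velocity_le hb hε hh n) hfield)
    _ = Real.exp (K * (n * h)) * velocityBound K L M ε (n * h) ‖v 0‖ := by
      rw [velocityBound]; ring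
    _ ≤ _ := by
      rw [velocityBound, velocityBound]
      gcongr

theorem IsOrbit.guidingCenter_succ (ho : IsOrbit ε h E x v) (hε : 0 < ε) (n : ℕ) :
    guidingCenter ε (x (n + 1)) (v (n + 1)) =
      guidingCenter ε (x n) (v n) - h • perp (E (n * h) (x n)) := by
  have hvel := congrArg (fun u => ε • perp u) (ho.vel n)
  simp only [perp_add, perp_smul, perp_perp, smul_add, smul_smul] at hvel
  rw [show ε * (h / ε ^ 2) = h / ε by field_simp, show ε * (h / ε) = h by field_simp] at hvel
  rw [guidingCenter, guidingCenter, ho.pos n]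
  linear_combination (norm := module) -hvel

end Orbit

section Window

variable {E : ℝ → Plane → Plane} {K L M : ℝ≥0} {ε h : ℝ} {x v : ℕ → Plane} {a m : ℕ}
  {e y : Plane} {c d δ W : ℝ}

theorem FieldBounds.norm_window_sub_le (hb : FieldBounds E K L M)
    (hh : 0 ≤ h) (hδ : ∀ i < m, ‖x (a + i) - y‖ ≤ δ) {i : ℕ} (hi : i < m) :
    ‖E ((a + i : ℕ) * h) (x (a + i)) - E (a * h) y‖ ≤ L * (m * h) + K * δ := by
  refine (hb.norm_sub_le (by positivity) (by positivity) _ _).trans ?_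
  rw [show ((a + i : ℕ) : ℝ) * h - a * h = i * h by push_cast; ring, abs_of_nonneg (by positivity)]
  gcongr
  exact hδ i hi

theorem IsOrbit.norm_guidingCenter_sub_add_le (ho : IsOrbit ε h E x v) (hε : 0 < ε) (hh : 0 ≤ h)
    (hc : ∀ i < m, ‖E ((a + i : ℕ) * h) (x (a + i)) - e‖ ≤ c) :
    ‖guidingCenter ε (x (a + m)) (v (a + m)) - guidingCenter ε (x a) (v a) + (m * h) • perp e‖ ≤
      m * h * c := by
  refine le_of_eq_of_le ?_ ((norm_add_sub_smul_le (a := a)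
    (u := fun n => guidingCenter ε (x n) (v n)) (d := -(h • perp e)) (c := h * c)
    fun i hi => ?_).trans_eq (mul_assoc _ _ _).symm)
  · congr 1
    module
  · have hstep : guidingCenter ε (x (a + i + 1)) (v (a + i + 1)) -
        guidingCenter ε (x (a + i)) (v (a + i)) - -(h • perp e) =
        -(h • perp (E ((a + i : ℕ) * h) (x (a + i)) - e)) := by
      rw [ho.guidingCenter_succ hε, perp_sub]; module
    rw [hstep, norm_neg, norm_smul_perp hh]
    gcongr
    exact hc i hi

theorem IsOrbit.norm_velocity_sub_sub_le (ho : IsOrbit ε h E x v) (hε : 0 < ε) (hh : 0 ≤ h)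
    (hc : ∀ i < m, ‖E ((a + i : ℕ) * h) (x (a + i)) - e‖ ≤ c)
    (hd : ∀ i < m, ‖v (a + m) - v (a + i + 1)‖ ≤ d) :
    ‖v (a + m) + (m * h / ε ^ 2) • perp (v (a + m)) - v a - (m * h / ε) • e‖ ≤
      m * h / ε * c + m * h / ε ^ 2 * d := by
  refine le_of_eq_of_le ?_ ((norm_add_sub_smul_le (a := a) (u := v)
    (d := (h / ε) • e - (h / ε ^ 2) • perp (v (a + m))) (c := h / ε * c + h / ε ^ 2 * d)
    fun i hi => ?_).trans_eq (by ring))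
  · congr 1
    module
  · have hstep : v (a + i + 1) - v (a + i) - ((h / ε) • e - (h / ε ^ 2) • perp (v (a + m))) =
        (h / ε) • (E ((a + i : ℕ) * h) (x (a + i)) - e) +
          (h / ε ^ 2) • perp (v (a + m) - v (a + i + 1)) := by
      rw [perp_sub]
      linear_combination (norm := module) ho.vel (a + i)
    rw [hstep]
    refine (norm_add_le _ _).trans ?_
    rw [norm_smul_perp (by positivity), norm_smul_of_nonneg (by positivity)]
    gcongr
    · exact hc i hi
    · exact hd i hi

theorem IsOrbit.norm_velocity_succ_sub_le (ho : IsOrbit ε h E x v) (hb : FieldBounds E K L M)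
    (hε : 0 < ε) (hh : 0 ≤ h) {n : ℕ} (hW : ‖v (n + 1)‖ ≤ W) :
    ‖v (n + 1) - v n‖ ≤ h * (M / ε + W / ε ^ 2) := by
  have hstep : v (n + 1) - v n =
      (h / ε) • E (n * h) (x n) - (h / ε ^ 2) • perp (v (n + 1)) := by
    linear_combination (norm := module) ho.vel n
  calc ‖v (n + 1) - v n‖ ≤ h / ε * ‖E (n * h) (x n)‖ + h / ε ^ 2 * ‖v (n + 1)‖ := by
        rw [hstep, ← norm_smul_of_nonneg (by positivity), ← norm_smul_perp (by positivity)]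
        exact norm_sub_le _ _
    _ ≤ h / ε * M + h / ε ^ 2 * W := by
        gcongr
        exact hb.size _ (by positivity) _
    _ = _ := by ring

theorem IsOrbit.norm_velocity_sub_le (ho : IsOrbit ε h E x v) (hb : FieldBounds E K L M)
    (hε : 0 < ε) (hh : 0 ≤ h) (hW : ∀ j ≤ a + m, ‖v j‖ ≤ W) {i : ℕ} (hi : i < m) :
    ‖v (a + m) - v (a + i + 1)‖ ≤ m * h * (M / ε + W / ε ^ 2) := by
  have hW0 : 0 ≤ W := (norm_nonneg _).trans (hW 0 (by omega))
  have hsum := norm_add_sub_le (u := v) (a := a + i + 1) (m := m - (i + 1)) fun j hj =>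
    ho.norm_velocity_succ_sub_le hb hε hh (hW _ (by omega))
  rw [show a + i + 1 + (m - (i + 1)) = a + m by omega] at hsum
  refine hsum.trans ?_
  rw [← mul_assoc]
  gcongr
  omega

theorem IsOrbit.norm_pos_sub_le (ho : IsOrbit ε h E x v) (hε : 0 < ε) (hh : 0 ≤ h)
    (hW : ∀ j ≤ a + m, ‖v j‖ ≤ W) {i : ℕ} (hi : i ≤ m) :
    ‖x (a + i) - x a‖ ≤ m * h / ε * W := by
  have hW0 : 0 ≤ W := (norm_nonneg _).trans (hW 0 (by omega))
  calc ‖x (a + i) - x a‖ ≤ i * (h / ε * W) := norm_add_sub_le fun j hj => by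
        rw [ho.norm_pos_succ_sub hε hh]
        gcongr
        exact hW _ (by omega)
    _ ≤ m * (h / ε * W) := by gcongr
    _ = _ := by ring

theorem IsOrbit.norm_guidingCenter_sub_le (ho : IsOrbit ε h E x v) (hb : FieldBounds E K L M)
    (hε : 0 < ε) (hh : 0 ≤ h) {i : ℕ} (hi : i ≤ m) :
    ‖guidingCenter ε (x (a + i)) (v (a + i)) - guidingCenter ε (x a) (v a)‖ ≤ m * h * M := by
  calc _ ≤ i * (h * M) := norm_add_sub_le (u := fun j => guidingCenter ε (x j) (v j))
        fun j _ => by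
          rw [ho.guidingCenter_succ hε, sub_sub_cancel_left, norm_neg, norm_smul_perp hh]
          gcongr
          exact hb.size _ (by positivity) _
    _ ≤ m * (h * M) := by gcongr
    _ = _ := (mul_assoc _ _ _).symm

end Window

section Refinement

variable {E : ℝ → Plane → Plane} {K L M : ℝ≥0} {ε h : ℝ} {X V x v : ℕ → Plane} {m n N : ℕ}
  {d δ T : ℝ}

theorem IsOrbit.norm_guidingCenter_refinement_succ_le (hO : IsOrbit ε (m * h) E X V)
    (ho : IsOrbit ε h E x v) (hb : FieldBounds E K L M) (hε : 0 < ε) (hh : 0 ≤ h)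
    (hδ : ∀ i < m, ‖x (n * m + i) - X n‖ ≤ δ) :
    ‖guidingCenter ε (X (n + 1)) (V (n + 1)) -
        guidingCenter ε (x ((n + 1) * m)) (v ((n + 1) * m))‖ ≤
      ‖guidingCenter ε (X n) (V n) - guidingCenter ε (x (n * m)) (v (n * m))‖ +
        m * h * (L * (m * h) + K * δ) := by
  have htime : (n : ℝ) * (m * h) = (n * m : ℕ) * h := by push_cast; ring
  have hdefect := ho.norm_guidingCenter_sub_add_le hε hh fun i hi =>
    hb.norm_window_sub_le hh hδ hi
  rw [hO.guidingCenter_succ hε, htime, Nat.succ_mul]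
  refine (norm_sub_le_of_le (le_refl _) hdefect).trans' (le_of_eq (congrArg norm ?_))
  module

theorem IsOrbit.norm_velocity_refinement_succ_le (hO : IsOrbit ε (m * h) E X V)
    (ho : IsOrbit ε h E x v) (hb : FieldBounds E K L M) (hε : 0 < ε) (hh : 0 ≤ h)
    (hδ : ∀ i < m, ‖x (n * m + i) - X n‖ ≤ δ)
    (hd : ∀ i < m, ‖v (n * m + m) - v (n * m + i + 1)‖ ≤ d) :
    ‖V (n + 1) - v ((n + 1) * m)‖ ≤ ‖V n - v (n * m)‖ +
      (m * h / ε * (L * (m * h) + K * δ) + m * h / ε ^ 2 * d) := by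
  have htime : (n : ℝ) * (m * h) = (n * m : ℕ) * h := by push_cast; ring
  have hvel := hO.vel n
  have hdefect := ho.norm_velocity_sub_sub_le hε hh
    (fun i hi => hb.norm_window_sub_le hh hδ hi) hd
  rw [htime] at hvel
  rw [Nat.succ_mul]
  refine (norm_le_norm_add_smul_perp (m * h / ε ^ 2) _).trans
    ((norm_sub_le_of_le (le_refl _) hdefect).trans' (le_of_eq (congrArg norm ?_)))
  rw [perp_sub]
  linear_combination (norm := module) hvel

theorem IsOrbit.norm_refined_velocity_le (ho : IsOrbit ε h E x v) (hb : FieldBounds E K L M)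
    (hε : 0 < ε) (hh : 0 ≤ h) (hn : n ≤ N) (hT : N * (m * h) = T) {j : ℕ} (hj : j ≤ n * m) :
    ‖v j‖ ≤ Real.exp (K * (m * h) * n) * velocityBound K L M ε T ‖v 0‖ := by
  have hj' : (j : ℝ) ≤ n * m := by exact_mod_cast hj
  rw [show (K : ℝ) * (m * h) * n = K * (n * (m * h)) by ring]
  refine ho.norm_velocity_le hb hε hh ?_ ?_
  · rw [← mul_assoc]
    gcongr
  · rw [← hT]
    gcongr

theorem IsOrbit.gyroDist_refinement_succ_le (hO : IsOrbit ε (m * h) E X V)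
    (ho : IsOrbit ε h E x v) (hb : FieldBounds E K L M) (hε : 0 < ε) (hh : 0 ≤ h) {W : ℝ}
    (hW : ∀ j ≤ n * m + m, ‖v j‖ ≤ W) :
    gyroDist ε (X (n + 1)) (V (n + 1)) (x ((n + 1) * m)) (v ((n + 1) * m)) ≤
      (1 + 2 * K * (m * h)) * gyroDist ε (X n) (V n) (x (n * m)) (v (n * m)) +
        (m * h) ^ 2 * (2 * (L + K * W / ε) + M / ε ^ 2 + W / ε ^ 3) := by
  have hδ : ∀ i < m, ‖x (n * m + i) - X n‖ ≤
      m * h / ε * W + gyroDist ε (X n) (V n) (x (n * m)) (v (n * m)) := fun i hi =>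
    (norm_sub_le_norm_sub_add_norm_sub _ (x (n * m)) _).trans
      (add_le_add (ho.norm_pos_sub_le hε hh hW hi.le)
        (norm_sub_rev (X n) _ ▸ norm_sub_le_gyroDist hε.le _ _ _ _))
  have hcenter := hO.norm_guidingCenter_refinement_succ_le ho hb hε hh hδ
  have hvelocity := mul_le_mul_of_nonneg_left (hO.norm_velocity_refinement_succ_le ho hb hε hh hδ
    fun i hi => ho.norm_velocity_sub_le hb hε hh hW hi) hε.le
  refine (add_le_add hcenter hvelocity).trans_eq ?_
  simp only [gyroDist]
  field_simp
  ring

theorem IsOrbit.norm_refinement_sub_le_stiff (hO : IsOrbit ε (m * h) E X V)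
    (ho : IsOrbit ε h E x v) (hx : X 0 = x 0) (hv : V 0 = v 0) (hb : FieldBounds E K L M)
    (hε : 0 < ε) (hh : 0 ≤ h) (hT : N * (m * h) = T) {W : ℝ}
    (hW : velocityBound K L M ε T ‖v 0‖ = W) :
    ‖X N - x (N * m)‖ ≤ Real.exp (2 * K * T) *
      (T * (m * h) * (2 * (L + K * W / ε) + M / ε ^ 2 + W / ε ^ 3)) := by
  have hT0 : 0 ≤ T := hT ▸ by positivity
  have hW0 : 0 ≤ W := by rw [← hW, velocityBound]; positivity
  set H : ℝ := m * h
  set D : ℕ → ℝ := fun n => gyroDist ε (X n) (V n) (x (n * m)) (v (n * m)) with hD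
  have hD0 : D 0 = 0 := by simp [hD, gyroDist, hx, hv]
  have hstep : ∀ n < N, D (n + 1) ≤ (1 + 2 * K * H) * D n + Real.exp (2 * K * H * (n + 1)) *
      (H ^ 2 * (2 * (L + K * W / ε) + M / ε ^ 2 + W / ε ^ 3)) := by
    intro n hn
    set G := Real.exp (2 * K * H * (n + 1)) with hG
    have hG1 : 1 ≤ G := Real.one_le_exp (by positivity)
    have hspeed : ∀ j ≤ n * m + m, ‖v j‖ ≤ G * W := fun j hj => by
      refine (ho.norm_refined_velocity_le hb hε hh (Nat.succ_le_of_lt hn) hT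
        (hj.trans_eq (Nat.succ_mul n m).symm)).trans ?_
      have hrate : 0 ≤ K * H * (n + 1) := by positivity
      rw [hW, hG, Nat.cast_succ]
      gcongr ?_ * W
      exact Real.exp_le_exp.2 (by linarith)
    calc D (n + 1) ≤ (1 + 2 * K * H) * D n +
          H ^ 2 * (2 * (L + K * (G * W) / ε) + M / ε ^ 2 + G * W / ε ^ 3) :=
        hO.gyroDist_refinement_succ_le ho hb hε hh hspeed
      _ ≤ (1 + 2 * K * H) * D n +
          H ^ 2 * (2 * (G * L + K * (G * W) / ε) + G * M / ε ^ 2 + G * W / ε ^ 3) := by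
        gcongr
        · exact le_mul_of_one_le_left L.coe_nonneg hG1
        · exact le_mul_of_one_le_left M.coe_nonneg hG1
      _ = _ := by ring
  refine (norm_sub_le_gyroDist hε.le _ _ _ _).trans ((discrete_gronwall (by positivity)
    (by positivity) hD0.ge hstep).trans_eq ?_)
  rw [hD0, ← hT]
  ring_nf

theorem IsOrbit.norm_guidingCenter_refinement_succ_le_uniform (hO : IsOrbit ε (m * h) E X V)
    (ho : IsOrbit ε h E x v) (hb : FieldBounds E K L M) (hε : 0 < ε) (hh : 0 ≤ h) {w : ℝ}
    (hw : ∀ i < m, ‖v (n * m + i) - V n‖ ≤ w) :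
    ‖guidingCenter ε (X (n + 1)) (V (n + 1)) -
        guidingCenter ε (x ((n + 1) * m)) (v ((n + 1) * m))‖ ≤
      (1 + K * (m * h)) *
          ‖guidingCenter ε (X n) (V n) - guidingCenter ε (x (n * m)) (v (n * m))‖ +
        m * h * ((L + K * M) * (m * h) + K * ε * w) := by
  have hδ : ∀ i < m, ‖x (n * m + i) - X n‖ ≤ m * h * M +
      ‖guidingCenter ε (X n) (V n) - guidingCenter ε (x (n * m)) (v (n * m))‖ + ε * w := by
    intro i hi
    have hcenter := norm_sub_le_norm_sub_add_norm_sub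
      (guidingCenter ε (x (n * m + i)) (v (n * m + i)))
      (guidingCenter ε (x (n * m)) (v (n * m))) (guidingCenter ε (X n) (V n))
    rw [norm_sub_rev (guidingCenter ε (x (n * m)) _)] at hcenter
    refine (norm_sub_le_gyroDist hε.le _ (v (n * m + i)) _ (V n)).trans (add_le_add
      (hcenter.trans (add_le_add_left (ho.norm_guidingCenter_sub_le hb hε hh hi.le) _)) ?_)
    gcongr
    exact hw i hi
  refine (hO.norm_guidingCenter_refinement_succ_le ho hb hε hh hδ).trans_eq ?_
  ring

theorem IsOrbit.norm_refined_velocity_sub_le (hO : IsOrbit ε (m * h) E X V)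
    (ho : IsOrbit ε h E x v) (hv : V 0 = v 0) (hb : FieldBounds E K L M) (hε : 0 < ε)
    (hh : 0 ≤ h) (hn : n ≤ N) (hT : N * (m * h) = T) {j k : ℕ} (hj : j ≤ n * m) (hk : k ≤ n) :
    ‖v j - V k‖ ≤ 2 * (Real.exp (K * (m * h) * n) * velocityBound K L M ε T ‖v 0‖) := by
  have hfine := ho.norm_refined_velocity_le hb hε hh hn hT hj
  have hcoarse : ‖V k‖ ≤ Real.exp (K * (m * h) * n) * velocityBound K L M ε T ‖v 0‖ := by
    rw [← hv, mul_assoc, mul_comm (m * h)]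
    exact hO.norm_velocity_le hb hε (by positivity) (by gcongr) (by rw [← hT]; gcongr)
  rw [two_mul]
  exact norm_sub_le_of_le hfine hcoarse

theorem IsOrbit.norm_refinement_sub_le_uniform (hO : IsOrbit ε (m * h) E X V)
    (ho : IsOrbit ε h E x v) (hx : X 0 = x 0) (hv : V 0 = v 0) (hb : FieldBounds E K L M)
    (hε : 0 < ε) (hh : 0 ≤ h) (hT : N * (m * h) = T) {W : ℝ}
    (hW : velocityBound K L M ε T ‖v 0‖ = W) :
    ‖X N - x (N * m)‖ ≤ Real.exp (K * T) *
      (T * ((L + K * M) * (m * h) + 2 * K * ε * W) + 2 * ε * W) := by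
  have hT0 : 0 ≤ T := hT ▸ by positivity
  have hW0 : 0 ≤ W := by rw [← hW, velocityBound]; positivity
  set H : ℝ := m * h
  set D : ℕ → ℝ := fun n => ‖guidingCenter ε (X n) (V n) -
    guidingCenter ε (x (n * m)) (v (n * m))‖ with hD
  have hD0 : D 0 = 0 := by simp [hD, hx, hv]
  have hstep : ∀ n < N, D (n + 1) ≤ (1 + K * H) * D n + Real.exp (K * H * (n + 1)) *
      (H * ((L + K * M) * H + 2 * K * ε * W)) := by
    intro n hn
    set G := Real.exp (K * H * (n + 1)) with hG
    have hG1 : 1 ≤ G := Real.one_le_exp (by positivity)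
    have hw : ∀ i < m, ‖v (n * m + i) - V n‖ ≤ 2 * (G * W) := fun i hi => by
      rw [hG, ← Nat.cast_succ]
      exact hW ▸ hO.norm_refined_velocity_sub_le ho hv hb hε hh hn hT
        (by rw [Nat.succ_mul]; lia) n.le_succ
    calc D (n + 1) ≤ (1 + K * H) * D n + H * ((L + K * M) * H + K * ε * (2 * (G * W))) :=
          hO.norm_guidingCenter_refinement_succ_le_uniform ho hb hε hh hw
      _ ≤ (1 + K * H) * D n + H * (G * ((L + K * M) * H) + K * ε * (2 * (G * W))) := by
          refine add_le_add le_rfl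
            (mul_le_mul_of_nonneg_left (add_le_add ?_ le_rfl) (by positivity))
          exact le_mul_of_one_le_left (by positivity) hG1
      _ = _ := by ring
  have hDN : D N ≤ Real.exp (K * T) * (T * ((L + K * M) * H + 2 * K * ε * W)) := by
    refine (discrete_gronwall (by positivity) (by positivity) hD0.ge hstep).trans_eq ?_
    rw [hD0, ← hT]
    ring_nf
  have hVN := hO.norm_refined_velocity_sub_le ho hv hb hε hh le_rfl hT le_rfl le_rfl
  rw [norm_sub_rev, mul_assoc (K : ℝ), mul_comm (m * h), hT, hW] at hVN
  calc ‖X N - x (N * m)‖ ≤ D N + ε * ‖V N - v (N * m)‖ := norm_sub_le_gyroDist hε.le _ _ _ _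
    _ ≤ Real.exp (K * T) * (T * ((L + K * M) * H + 2 * K * ε * W)) +
        ε * (2 * (Real.exp (K * T) * W)) := by gcongr
    _ = _ := by ring

end Refinement

section Rates

variable {K L M : ℝ≥0} {c ε H T Q W : ℝ}

theorem velocityBound_le {r : ℝ} (hε : 0 ≤ ε) (hT : 0 ≤ T) (hr : 0 ≤ r) :
    velocityBound K L M ε T r ≤ (1 + 2 * M + L + K * M) * ((1 + T) * (1 + ε + r)) := by
  have hdefect : (1 + 2 * M + L + K * M) * ((1 + T) * (1 + ε + r)) - velocityBound K L M ε T r =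
      (1 + 2 * M + L + K * M) * (1 + T + T * r) + r * (2 * M + L + K * M) +
        ε * (1 + L + K * M) + T * ε * (1 + 2 * M) := by
    rw [velocityBound]; ring
  exact sub_nonneg.1 (hdefect ▸ by positivity)

theorem stiff_rate_le (hε : 0 < ε) (hc : 0 ≤ c) (hεQ : ε ≤ Q) (hW0 : 0 ≤ W)
    (hW : W ≤ c * Q) :
    2 * (L + K * W / ε) + M / ε ^ 2 + W / ε ^ 3 ≤
      (2 * L + 2 * K * c + M + c) * ((1 + ε ^ 2) / ε ^ 3 * Q) := by
  have hQ : 0 ≤ Q := hε.le.trans hεQ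
  calc _ = (2 * L * (ε ^ 2 * ε) + 2 * K * (ε ^ 2 * W) + M * (1 * ε) + 1 * W) / ε ^ 3 := by
        field_simp
    _ ≤ (2 * L * ((1 + ε ^ 2) * Q) + 2 * K * ((1 + ε ^ 2) * (c * Q)) + M * ((1 + ε ^ 2) * Q) +
          (1 + ε ^ 2) * (c * Q)) / ε ^ 3 := by
        have hone : 1 ≤ 1 + ε ^ 2 := le_add_of_nonneg_right (sq_nonneg ε)
        have hsq : ε ^ 2 ≤ 1 + ε ^ 2 := le_add_of_nonneg_left zero_le_one
        gcongr ?_ / ε ^ 3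
        refine add_le_add (add_le_add (add_le_add ?_ ?_) ?_)
          ((mul_le_mul_of_nonneg_left hW zero_le_one).trans ?_)
        all_goals gcongr
    _ = _ := by ring

theorem uniform_rate_le (hε : 0 ≤ ε) (hH : 0 ≤ H) (hT : 0 ≤ T) (hc : 0 ≤ c) (hQ : 1 ≤ Q)
    (hW : W ≤ c * Q) :
    T * ((L + K * M) * H + 2 * K * ε * W) + 2 * ε * W ≤
      (L + K * M + 2 * K * c + 2 * c) * (H + ε) * ((1 + T) * Q) := by
  calc _ ≤ T * ((L + K * M) * (H * Q) + 2 * K * ε * (c * Q)) + 2 * ε * (c * Q) := by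
        gcongr
        exact le_mul_of_one_le_right hH hQ
    _ ≤ (1 + T) * ((L + K * M) * ((H + ε) * Q) + 2 * K * (H + ε) * (c * Q)) +
          (1 + T) * (2 * (H + ε) * (c * Q)) := by
        refine add_le_add ?_ ((le_mul_of_one_le_left (by positivity) (by linarith)).trans' ?_)
        all_goals gcongr <;> linarith
    _ = _ := by ring

theorem one_add_sq_le (T : ℝ) : (1 + T) ^ 2 ≤ 2 * (1 + T ^ 2) := by
  linarith [sq_nonneg (T - 1), add_sq 1 T, sub_sq T 1]

end Rates

section RefinementRates

variable {E : ℝ → Plane → Plane} {K L M : ℝ≥0} {ε h T c P : ℝ} {X V x v : ℕ → Plane} {m N : ℕ}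

theorem IsOrbit.norm_refinement_sub_le_stiff_rate (hO : IsOrbit ε (m * h) E X V)
    (ho : IsOrbit ε h E x v) (hx : X 0 = x 0) (hv : V 0 = v 0) (hb : FieldBounds E K L M)
    (hε : 0 < ε) (hh : 0 ≤ h) (hT : N * (m * h) = T) (hc : 1 + 2 * M + L + K * M = c)
    (hP : 1 + ε + ‖v 0‖ = P) :
    ‖X N - x (N * m)‖ ≤ 2 * (2 * L + 2 * K * c + M + c) * (m * h / ε ^ 3 * (1 + ε ^ 2)) *
      Real.exp (2 * K * T) * (1 + T ^ 2) * P := by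
  have hT0 : 0 ≤ T := hT ▸ by positivity
  have hc0 : 0 ≤ c := hc ▸ by positivity
  have hεP : ε ≤ P := by linarith [norm_nonneg (v 0)]
  have hP0 : 0 ≤ P := hε.le.trans hεP
  have hW : velocityBound K L M ε T ‖v 0‖ ≤ c * ((1 + T) * P) :=
    hc ▸ hP ▸ velocityBound_le hε.le hT0 (norm_nonneg _)
  have hεQ : ε ≤ (1 + T) * P := hεP.trans (le_mul_of_one_le_left hP0 (by linarith))
  have hTsq : T * (1 + T) ≤ 2 * (1 + T ^ 2) := by linarith [one_add_sq_le T]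
  calc ‖X N - x (N * m)‖ ≤ Real.exp (2 * K * T) * (T * (m * h) *
          ((2 * L + 2 * K * c + M + c) * ((1 + ε ^ 2) / ε ^ 3 * ((1 + T) * P)))) :=
        (hO.norm_refinement_sub_le_stiff ho hx hv hb hε hh hT rfl).trans (by
          gcongr
          exact stiff_rate_le hε hc0 hεQ (by rw [velocityBound]; positivity) hW)
    _ = (2 * L + 2 * K * c + M + c) * (m * h / ε ^ 3 * (1 + ε ^ 2)) * Real.exp (2 * K * T) *
          (T * (1 + T)) * P := by ring
    _ ≤ (2 * L + 2 * K * c + M + c) * (m * h / ε ^ 3 * (1 + ε ^ 2)) * Real.exp (2 * K * T) *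
          (2 * (1 + T ^ 2)) * P := by gcongr
    _ = _ := by ring

theorem IsOrbit.norm_refinement_sub_le_uniform_rate (hO : IsOrbit ε (m * h) E X V)
    (ho : IsOrbit ε h E x v) (hx : X 0 = x 0) (hv : V 0 = v 0) (hb : FieldBounds E K L M)
    (hε : 0 < ε) (hh : 0 ≤ h) (hT : N * (m * h) = T) (hc : 1 + 2 * M + L + K * M = c)
    (hP : 1 + ε + ‖v 0‖ = P) :
    ‖X N - x (N * m)‖ ≤ 2 * (L + K * M + 2 * K * c + 2 * c) * (m * h + ε) *
      Real.exp (2 * K * T) * (1 + T ^ 2) * P := by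
  have hT0 : 0 ≤ T := hT ▸ by positivity
  have hc0 : 0 ≤ c := hc ▸ by positivity
  have hP1 : 1 ≤ P := by linarith [norm_nonneg (v 0)]
  have hW : velocityBound K L M ε T ‖v 0‖ ≤ c * ((1 + T) * P) :=
    hc ▸ hP ▸ velocityBound_le hε.le hT0 (norm_nonneg _)
  have hQ1 : 1 ≤ (1 + T) * P := one_le_mul_of_one_le_of_one_le (by linarith) hP1
  have hexp : Real.exp (K * T) ≤ Real.exp (2 * K * T) := by
    gcongr
    exact le_mul_of_one_le_left K.coe_nonneg one_le_two
  calc ‖X N - x (N * m)‖ ≤ Real.exp (2 * K * T) *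
          ((L + K * M + 2 * K * c + 2 * c) * (m * h + ε) * ((1 + T) * ((1 + T) * P))) :=
        (hO.norm_refinement_sub_le_uniform ho hx hv hb hε hh hT rfl).trans (mul_le_mul hexp
          (uniform_rate_le hε.le (by positivity) hT0 hc0 hQ1 hW)
          (by rw [velocityBound]; positivity) (by positivity))
    _ = (L + K * M + 2 * K * c + 2 * c) * (m * h + ε) * Real.exp (2 * K * T) *
          (1 + T) ^ 2 * P := by ring
    _ ≤ (L + K * M + 2 * K * c + 2 * c) * (m * h + ε) * Real.exp (2 * K * T) *
          (2 * (1 + T ^ 2)) * P := by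
        gcongr
        exact one_add_sq_le T
    _ = _ := by ring

theorem FieldBounds.exists_norm_discreteFlow_refinement_sub_le (hb : FieldBounds E K L M) :
    ∃ C > 0, ∀ ε Δt : ℝ, 0 < ε → 0 ≤ Δt → ∀ m : ℕ, m ≠ 0 → ∀ (n : ℕ) (p : Phase),
      ‖(discreteFlow ε Δt E n p).1 - (discreteFlow ε (Δt / m) E (n * m) p).1‖ ≤
        C * min (Δt / ε ^ 3 * (1 + ε ^ 2)) (Δt + ε) * Real.exp (2 * K * (n * Δt)) *
          (1 + (n * Δt) ^ 2) * (1 + ε + ‖p.2‖) := by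
  obtain ⟨c, hc⟩ : ∃ c : ℝ, 1 + 2 * M + L + K * M = c := ⟨_, rfl⟩
  have hc0 : 0 < c := hc ▸ by positivity
  set A : ℝ := 2 * (2 * L + 2 * K * c + M + c) with hA
  set B : ℝ := 2 * (L + K * M + 2 * K * c + 2 * c) with hB
  refine ⟨A + B, by positivity, fun ε Δt hε hΔt m hm n p => ?_⟩
  have hstep : (m : ℝ) * (Δt / m) = Δt := by field_simp
  have hO := isOrbit_discreteFlow ε (m * (Δt / m)) E p
  have ho := isOrbit_discreteFlow ε (Δt / m) E p
  have hstiff := hO.norm_refinement_sub_le_stiff_rate ho rfl rfl hb hε (by positivity)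
    (N := n) rfl hc rfl
  have huniform := hO.norm_refinement_sub_le_uniform_rate ho rfl rfl hb hε (by positivity)
    (N := n) rfl hc rfl
  simp only [hstep, ← hA, ← hB] at hstiff huniform
  change _ ≤ _ * (1 + ε + ‖p.2‖) at hstiff huniform
  rcases min_choice (Δt / ε ^ 3 * (1 + ε ^ 2)) (Δt + ε) with hmin | hmin <;> rw [hmin]
  · refine hstiff.trans ?_
    gcongr
    exact le_add_of_nonneg_right (by positivity)
  · refine huniform.trans ?_
    gcongr
    exact le_add_of_nonneg_left (by positivity)

end RefinementRates

theorem abs_integral_le_of_forall_abs_le {X : Type*} [MeasurableSpace X]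
    {μ : ProbabilityMeasure X} {F : X → ℝ} {c : ℝ} (hF : ∀ p, |F p| ≤ c) :
    |∫ p, F p ∂(μ : Measure X)| ≤ c := by
  simpa only [Real.norm_eq_abs, probReal_univ, mul_one] using
    norm_integral_le_of_norm_le_const (μ := (μ : Measure X)) (f := F) (C := c)
      (Filter.Eventually.of_forall hF)

section LipSupported

variable {V : Type*} [SeminormedAddCommGroup V] {φ : V → ℝ} {A A' R R' : ℝ≥0}

/-- The test functions of the duality argument: `φ` is `A`-Lipschitz and vanishes wherever
`R < 1 + ‖p‖`. The shift by `1` makes `R` control the linear growth of a velocity field on the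
support of `φ`. -/
structure LipSupported (A R : ℝ≥0) (φ : V → ℝ) : Prop where
  lip : LipschitzWith A φ
  zero : ∀ p, R < 1 + ‖p‖ → φ p = 0

namespace LipSupported

theorem mono (hφ : LipSupported A R φ) (hA : A ≤ A') (hR : R ≤ R') : LipSupported A' R' φ :=
  ⟨hφ.lip.weaken hA, fun p hp => hφ.zero p ((NNReal.coe_le_coe.2 hR).trans_lt hp)⟩

theorem comp {κ : ℝ≥0} {S : V → V} (hφ : LipSupported A R φ) (hS : LipschitzWith κ S)
    (hgrowth : ∀ p, 1 + ‖p‖ ≤ κ * (1 + ‖S p‖)) :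
    LipSupported (κ * A) (κ * R) (φ ∘ S) := by
  refine ⟨mul_comm A κ ▸ hφ.lip.comp hS, fun p hp => hφ.zero _ ?_⟩
  exact lt_of_mul_lt_mul_left (hp.trans_le (hgrowth p)) κ.coe_nonneg

theorem eventuallyEq_zero (hφ : LipSupported A R φ) {p : V} (hp : R < 1 + ‖p‖) :
    φ =ᶠ[nhds p] 0 := by
  filter_upwards [(isOpen_lt continuous_const (continuous_const.add continuous_norm)).mem_nhds hp]
    with q hq using hφ.zero q hq

end LipSupported

end LipSupported

section LipSupported

variable {V : Type*} [NormedAddCommGroup V] [NormedSpace ℝ V] {φ : V → ℝ} {A R : ℝ≥0}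

theorem LipSupported.fderiv_eq_zero (hφ : LipSupported A R φ) {p : V} (hp : R < 1 + ‖p‖) :
    fderiv ℝ φ p = 0 := by
  rw [(hφ.eventuallyEq_zero hp).fderiv_eq, fderiv_zero, Pi.zero_apply]

variable [FiniteDimensional ℝ V]

theorem LipSupported.hasCompactSupport (hφ : LipSupported A R φ) : HasCompactSupport φ := by
  have := FiniteDimensional.proper_real V
  refine HasCompactSupport.intro (isCompact_closedBall (0 : V) (R - 1)) fun p hp => hφ.zero p ?_
  rw [mem_closedBall_zero_iff, not_le] at hp
  linarith

theorem LipSupported.integrable [MeasurableSpace V] [BorelSpace V] (hφ : LipSupported A R φ)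
    (μ : Measure V) [IsFiniteMeasureOnCompacts μ] : Integrable φ μ :=
  hφ.lip.continuous.integrable_of_hasCompactSupport hφ.hasCompactSupport

end LipSupported

section Mollify

variable {V : Type*} [NormedAddCommGroup V] [NormedSpace ℝ V] [FiniteDimensional ℝ V]
  [MeasurableSpace V] [BorelSpace V] (η : ContDiffBump (0 : V)) {φ ψ : V → ℝ} {A R : ℝ≥0}

/-- The convolution of `φ` with the bump function `η` of total mass one. -/
noncomputable def mollify (η : ContDiffBump (0 : V)) (φ : V → ℝ) : V → ℝ :=
  convolution (η.normed Measure.addHaar) φ (ContinuousLinearMap.lsmul ℝ ℝ) Measure.addHaar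

theorem abs_integral_normed_mul_le {F : V → ℝ} {c : ℝ} (hF : ∀ q, ‖q‖ ≤ η.rOut → |F q| ≤ c) :
    |∫ q, η.normed Measure.addHaar q * F q ∂Measure.addHaar| ≤ c := by
  refine (norm_integral_le_of_norm_le (G := ℝ) (μ := (Measure.addHaar : Measure V))
    (η.integrable_normed.mul_const c) (Filter.Eventually.of_forall fun q => ?_)).trans_eq
    (by rw [integral_mul_const, η.integral_normed, one_mul])
  rw [norm_mul, Real.norm_of_nonneg (η.nonneg_normed q)]
  rcases le_or_gt ‖q‖ η.rOut with hq | hq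
  · exact mul_le_mul_of_nonneg_left (hF q hq) (η.nonneg_normed q)
  · have hzero : η.normed (Measure.addHaar : Measure V) q = 0 := by
      rw [← Function.notMem_support, η.support_normed_eq, mem_ball_zero_iff]
      exact hq.le.not_gt
    rw [hzero, zero_mul, zero_mul]

theorem abs_mollify_sub_mollify_le (hφ : Continuous φ) (hψ : Continuous ψ) {p p' : V} {c : ℝ}
    (h : ∀ q, ‖q‖ ≤ η.rOut → |φ (p - q) - ψ (p' - q)| ≤ c) :
    |mollify η φ p - mollify η ψ p'| ≤ c := by
  have hint : ∀ F : V → ℝ, Continuous F → ∀ p,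
      Integrable (fun q => η.normed Measure.addHaar q * F (p - q)) Measure.addHaar := fun F hF p =>
    (η.continuous_normed.mul (hF.comp (continuous_sub_left p))).integrable_of_hasCompactSupport
      η.hasCompactSupport_normed.mul_right
  simp only [mollify, convolution_lsmul, smul_eq_mul]
  rw [← integral_sub (hint φ hφ p) (hint ψ hψ p')]
  simp only [← mul_sub]
  exact abs_integral_normed_mul_le η h

theorem contDiff_mollify (hφ : Continuous φ) : ContDiff ℝ ∞ (mollify η φ) :=
  η.hasCompactSupport_normed.contDiff_convolution_left _ η.contDiff_normed hφ.locallyIntegrable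

theorem fderiv_mollify (hφ : Continuous φ) (p : V) : fderiv ℝ (mollify η φ) p =
    ∫ q, φ (p - q) • fderiv ℝ (η.normed (Measure.addHaar : Measure V)) q ∂Measure.addHaar := by
  rw [mollify, (η.hasCompactSupport_normed.hasFDerivAt_convolution_left
    (ContinuousLinearMap.lsmul ℝ ℝ) η.contDiff_normed hφ.locallyIntegrable p).fderiv,
    convolution_def]
  congr 1 with q u
  simp [mul_comm]

theorem exists_lipschitzWith_fderiv_mollify : ∃ B : ℝ≥0, ∀ (A : ℝ≥0) (φ : V → ℝ),
    LipschitzWith A φ → LipschitzWith (A * B) (fderiv ℝ (mollify η φ)) := by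
  set D := fderiv ℝ (η.normed (Measure.addHaar : Measure V))
  have hcont : Continuous D := η.contDiff_normed.continuous_fderiv one_ne_zero
  have hsupp : HasCompactSupport D := η.hasCompactSupport_normed.fderiv ℝ
  refine ⟨(∫ q, ‖D q‖ ∂Measure.addHaar).toNNReal,
    fun A φ hφ => LipschitzWith.of_dist_le_mul fun p p' => ?_⟩
  have hint : ∀ p, Integrable (fun q => φ (p - q) • D q) Measure.addHaar := fun p =>
    ((hφ.continuous.comp (continuous_sub_left p)).smul hcont).integrable_of_hasCompactSupport
      hsupp.smul_left
  rw [dist_eq_norm, fderiv_mollify η hφ.continuous, fderiv_mollify η hφ.continuous,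
    ← integral_sub (hint p) (hint p')]
  refine (norm_integral_le_of_norm_le ((hcont.integrable_of_hasCompactSupport hsupp).norm.const_mul
    (A * dist p p')) (Filter.Eventually.of_forall fun q => ?_)).trans_eq ?_
  · rw [← sub_smul, norm_smul, ← dist_eq_norm]
    gcongr
    exact (hφ.dist_le_mul _ _).trans_eq (by rw [dist_sub_right])
  · rw [integral_const_mul, NNReal.coe_mul,
      Real.coe_toNNReal _ (integral_nonneg fun _ => norm_nonneg _), mul_right_comm]

theorem abs_mollify_sub_le (hφ : LipschitzWith A φ) (p : V) :
    |mollify η φ p - φ p| ≤ A * η.rOut :=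
  η.dist_normed_convolution_le hφ.continuous.aestronglyMeasurable fun q hq =>
    (hφ.dist_le_mul q p).trans (mul_le_mul_of_nonneg_left (Metric.mem_ball.1 hq).le A.coe_nonneg)

theorem LipSupported.mollify (hφ : LipSupported A R φ) :
    LipSupported A (R + η.rOut.toNNReal) (mollify η φ) := by
  have hcont := hφ.lip.continuous
  refine ⟨LipschitzWith.of_dist_le_mul fun p p' => abs_mollify_sub_mollify_le η hcont hcont
    fun q _ => (hφ.lip.dist_le_mul _ _).trans_eq (by rw [dist_sub_right]), fun p hp => ?_⟩
  rw [NNReal.coe_add, Real.coe_toNNReal _ η.rOut_pos.le] at hp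
  simp only [GyroVlasov.mollify, convolution_lsmul, smul_eq_mul]
  refine abs_nonpos_iff.1 (abs_integral_normed_mul_le η fun q hq => ?_)
  rw [hφ.zero (p - q) (by linarith [norm_sub_norm_le p q]), abs_zero]

theorem LipSupported.abs_integral_mollify_sub_le (hφ : LipSupported A R φ)
    (μ : ProbabilityMeasure V) :
    |(∫ p, GyroVlasov.mollify η φ p ∂(μ : Measure V)) - ∫ p, φ p ∂(μ : Measure V)| ≤
      A * η.rOut := by
  rw [← integral_sub ((hφ.mollify η).integrable _) (hφ.integrable _)]
  exact abs_integral_le_of_forall_abs_le fun p => abs_mollify_sub_le η hφ.lip p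

end Mollify

theorem exists_contDiffBump_rOut_eq {V : Type*} [NormedAddCommGroup V] {δ : ℝ} (hδ : 0 < δ) :
    ∃ η : ContDiffBump (0 : V), η.rOut = δ :=
  ⟨⟨δ / 2, δ, half_pos hδ, half_lt_self hδ⟩, rfl⟩

section Transport

variable {V : Type*} [NormedAddCommGroup V] {b : ℝ → V → V} {A B R Λ : ℝ≥0} {φ : V → ℝ} {s t : ℝ}

/-- The regularity of a velocity field `b` on `t ≥ 0` under which one-step schemes converge:
`Λ`-Lipschitz in space and in time, and of linear growth. -/
structure VelocityBounds (b : ℝ → V → V) (Λ : ℝ≥0) : Prop where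
  space : ∀ t, 0 ≤ t → LipschitzWith Λ (b t)
  time : ∀ p, LipschitzOnWith Λ (fun t => b t p) (Set.Ici 0)
  growth : ∀ t, 0 ≤ t → ∀ p, ‖b t p‖ ≤ Λ * (1 + ‖p‖)

theorem VelocityBounds.norm_le (hb : VelocityBounds b Λ) (ht : 0 ≤ t) {p : V} (hp : 1 + ‖p‖ ≤ R) :
    ‖b t p‖ ≤ Λ * R :=
  (hb.growth t ht p).trans (mul_le_mul_of_nonneg_left hp Λ.coe_nonneg)

variable [NormedSpace ℝ V]

theorem LipSupported.abs_fderiv_apply_le (hφ : LipSupported A R φ) (hb : VelocityBounds b Λ)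
    (ht : 0 ≤ t) (p : V) : |fderiv ℝ φ p (b t p)| ≤ A * (Λ * R) := by
  rcases lt_or_ge (R : ℝ) (1 + ‖p‖) with hp | hp
  · rw [hφ.fderiv_eq_zero hp, zero_apply, abs_zero]
    positivity
  · exact (fderiv ℝ φ p).le_of_opNorm_le_of_le (norm_fderiv_le_of_lipschitz ℝ hφ.lip)
      (hb.norm_le ht hp)

theorem abs_fderiv_apply_sub_le (hφ : LipschitzWith A φ) (hb : VelocityBounds b Λ)
    (hs : 0 ≤ s) (ht : 0 ≤ t) (p : V) :
    |fderiv ℝ φ p (b s p) - fderiv ℝ φ p (b t p)| ≤ A * (Λ * |s - t|) := by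
  rw [← map_sub]
  exact (fderiv ℝ φ p).le_of_opNorm_le_of_le (norm_fderiv_le_of_lipschitz ℝ hφ)
    ((hb.time p).norm_sub_le hs ht)

/-- Test functions smooth enough for the weak formulation, with quantified first and second
derivatives. -/
structure SmoothLipSupported (A B R : ℝ≥0) (φ : V → ℝ) : Prop extends LipSupported A R φ where
  contDiff : ContDiff ℝ ∞ φ
  lipschitz_fderiv : LipschitzWith B (fderiv ℝ φ)

namespace SmoothLipSupported

theorem lipSupported_fderiv_apply (hφ : SmoothLipSupported A B R φ) (hb : VelocityBounds b Λ)
    (ht : 0 ≤ t) :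
    LipSupported (A * Λ + B * (Λ * R)) R fun p => fderiv ℝ φ p (b t p) := by
  have hlip : ∀ p q, 1 + ‖q‖ ≤ R → |fderiv ℝ φ p (b t p) - fderiv ℝ φ q (b t q)| ≤
      (A * Λ + B * (Λ * R)) * ‖p - q‖ := by
    intro p q hq
    calc |fderiv ℝ φ p (b t p) - fderiv ℝ φ q (b t q)|
        = |fderiv ℝ φ p (b t p - b t q) + (fderiv ℝ φ p - fderiv ℝ φ q) (b t q)| := by
          rw [map_sub, sub_apply, sub_add_sub_cancel]
      _ ≤ A * (Λ * ‖p - q‖) + B * ‖p - q‖ * (Λ * R) := by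
          refine (abs_add_le _ _).trans (add_le_add ?_ ?_)
          · exact (fderiv ℝ φ p).le_of_opNorm_le_of_le (norm_fderiv_le_of_lipschitz ℝ hφ.lip)
              ((hb.space t ht).norm_sub_le p q)
          · exact (fderiv ℝ φ p - fderiv ℝ φ q).le_of_opNorm_le_of_le
              (hφ.lipschitz_fderiv.norm_sub_le p q) (hb.norm_le ht hq)
      _ = _ := by ring
  refine ⟨LipschitzWith.of_dist_le_mul fun p q => ?_,
    fun p hp => by rw [hφ.fderiv_eq_zero hp, zero_apply]⟩
  rw [Real.dist_eq, dist_eq_norm]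
  push_cast
  rcases le_or_gt (1 + ‖q‖) (R : ℝ) with hq | hq
  · exact hlip p q hq
  rcases le_or_gt (1 + ‖p‖) (R : ℝ) with hp | hp
  · rw [abs_sub_comm, norm_sub_rev]
    exact hlip q p hp
  · rw [hφ.fderiv_eq_zero hp, hφ.fderiv_eq_zero hq, zero_apply, zero_apply, sub_self, abs_zero]
    positivity

theorem abs_sub_sub_fderiv_le (hφ : SmoothLipSupported A B R φ) (p u : V) :
    |φ (p + u) - φ p - fderiv ℝ φ p u| ≤ B * ‖u‖ ^ 2 := by
  have hball : ∀ x ∈ Metric.closedBall p ‖u‖, ‖fderiv ℝ φ x - fderiv ℝ φ p‖ ≤ B * ‖u‖ :=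
    fun x hx => (hφ.lipschitz_fderiv.norm_sub_le x p).trans
      (mul_le_mul_of_nonneg_left (mem_closedBall_iff_norm.1 hx) B.coe_nonneg)
  have htaylor := (convex_closedBall p ‖u‖).norm_image_sub_le_of_norm_fderiv_le' (𝕜 := ℝ)
    (fun x _ => hφ.contDiff.differentiable (by simp) x) hball
    (Metric.mem_closedBall_self (norm_nonneg u)) (y := p + u) (by simp)
  rwa [add_sub_cancel_left, mul_assoc, ← sq] at htaylor

end SmoothLipSupported

variable [MeasurableSpace V]

/-- A curve of probability measures, continuous for the weak convergence of measures, which solves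
the transport equation `∂_t f + div (b f) = 0` weakly on `t ≥ 0`. -/
structure IsWeakTransport [OpensMeasurableSpace V] (b : ℝ → V → V) (f : ℝ → ProbabilityMeasure V) :
    Prop where
  cont : ContinuousOn f (Set.Ici 0)
  weak : ∀ φ : V → ℝ, ContDiff ℝ ∞ φ → HasCompactSupport φ → ∀ t : ℝ, 0 ≤ t →
    (∫ p, φ p ∂(f t : Measure V)) - ∫ p, φ p ∂(f 0 : Measure V) =
      ∫ s in (0 : ℝ)..t, ∫ p, fderiv ℝ φ p (b s p) ∂(f s : Measure V)

variable [FiniteDimensional ℝ V] [BorelSpace V] {f : ℝ → ProbabilityMeasure V}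

theorem LipSupported.continuousOn_integral (hφ : LipSupported A R φ)
    (hf : ContinuousOn f (Set.Ici 0)) :
    ContinuousOn (fun t => ∫ p, φ p ∂(f t : Measure V)) (Set.Ici 0) := by
  obtain ⟨c, hc⟩ := hφ.hasCompactSupport.exists_bound_of_continuous hφ.lip.continuous
  exact fun t ht => ProbabilityMeasure.tendsto_iff_forall_integral_tendsto.1 (hf t ht)
    (BoundedContinuousFunction.ofNormedAddCommGroup φ hφ.lip.continuous c hc)

theorem LipSupported.exists_smoothLipSupported_mollify (η : ContDiffBump (0 : V)) (A : ℝ≥0) :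
    ∃ B : ℝ≥0, ∀ (R : ℝ≥0) (φ : V → ℝ), LipSupported A R φ →
      SmoothLipSupported A B (R + η.rOut.toNNReal) (GyroVlasov.mollify η φ) := by
  obtain ⟨B, hB⟩ := exists_lipschitzWith_fderiv_mollify η
  exact ⟨A * B, fun R φ hφ =>
    ⟨hφ.mollify η, contDiff_mollify η hφ.lip.continuous, hB A φ hφ.lip⟩⟩

namespace SmoothLipSupported

theorem abs_integral_fderiv_sub_le (hφ : SmoothLipSupported A B R φ) (hb : VelocityBounds b Λ)
    (hs : 0 ≤ s) (ht : 0 ≤ t) (μ : ProbabilityMeasure V) :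
    |(∫ p, fderiv ℝ φ p (b s p) ∂(μ : Measure V)) - ∫ p, fderiv ℝ φ p (b t p) ∂(μ : Measure V)| ≤
      A * (Λ * |s - t|) := by
  rw [← integral_sub ((hφ.lipSupported_fderiv_apply hb hs).integrable _)
    ((hφ.lipSupported_fderiv_apply hb ht).integrable _)]
  exact abs_integral_le_of_forall_abs_le fun p => abs_fderiv_apply_sub_le hφ.lip hb hs ht p

theorem continuousOn_integral_fderiv (hφ : SmoothLipSupported A B R φ) (hb : VelocityBounds b Λ)
    (hf : ContinuousOn f (Set.Ici 0)) :
    ContinuousOn (fun s => ∫ p, fderiv ℝ φ p (b s p) ∂(f s : Measure V)) (Set.Ici 0) := by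
  intro t ht
  have hfrozen := (hφ.lipSupported_fderiv_apply hb ht).continuousOn_integral hf t ht
  have hmodulus : Filter.Tendsto (fun s => (A : ℝ) * (Λ * |s - t|)) (nhdsWithin t (Set.Ici 0))
      (nhds 0) :=
    (Continuous.tendsto' (by fun_prop) t 0 (by simp)).mono_left nhdsWithin_le_nhds
  have hdiff : Filter.Tendsto (fun s => (∫ p, fderiv ℝ φ p (b s p) ∂(f s : Measure V)) -
      ∫ p, fderiv ℝ φ p (b t p) ∂(f s : Measure V)) (nhdsWithin t (Set.Ici 0)) (nhds 0) := by
    refine squeeze_zero_norm' ?_ hmodulus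
    filter_upwards [self_mem_nhdsWithin] with s hs
    exact hφ.abs_integral_fderiv_sub_le hb hs ht (f s)
  simpa only [ContinuousWithinAt, sub_add_cancel, zero_add] using hdiff.add hfrozen

theorem intervalIntegrable (hφ : SmoothLipSupported A B R φ) (hb : VelocityBounds b Λ)
    (hf : ContinuousOn f (Set.Ici 0)) (hs : 0 ≤ s) (ht : 0 ≤ t) :
    IntervalIntegrable (fun r => ∫ p, fderiv ℝ φ p (b r p) ∂(f r : Measure V)) volume s t :=
  ((hφ.continuousOn_integral_fderiv hb hf).mono fun _ hr =>
    (le_min hs ht).trans hr.1).intervalIntegrable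

theorem integral_sub_eq (hφ : SmoothLipSupported A B R φ) (hb : VelocityBounds b Λ)
    (hf : IsWeakTransport b f) (hs : 0 ≤ s) (ht : 0 ≤ t) :
    (∫ p, φ p ∂(f t : Measure V)) - ∫ p, φ p ∂(f s : Measure V) =
      ∫ r in s..t, ∫ p, fderiv ℝ φ p (b r p) ∂(f r : Measure V) := by
  rw [← intervalIntegral.integral_interval_sub_left (hφ.intervalIntegrable hb hf.cont le_rfl ht)
    (hφ.intervalIntegrable hb hf.cont le_rfl hs), ← hf.weak φ hφ.contDiff hφ.hasCompactSupport s hs,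
    ← hf.weak φ hφ.contDiff hφ.hasCompactSupport t ht, sub_sub_sub_cancel_right]

theorem abs_integral_sub_le (hφ : SmoothLipSupported A B R φ) (hb : VelocityBounds b Λ)
    (hf : IsWeakTransport b f) (hs : 0 ≤ s) (hst : s ≤ t) :
    |(∫ p, φ p ∂(f t : Measure V)) - ∫ p, φ p ∂(f s : Measure V)| ≤ A * (Λ * R) * (t - s) := by
  rw [hφ.integral_sub_eq hb hf hs (hs.trans hst), ← Real.norm_eq_abs,
    ← abs_of_nonneg (sub_nonneg.2 hst)]
  refine intervalIntegral.norm_integral_le_of_norm_le_const fun r hr => ?_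
  rw [Set.uIoc_of_le hst] at hr
  exact abs_integral_le_of_forall_abs_le fun p => hφ.abs_fderiv_apply_le hb (hs.trans hr.1.le) p

end SmoothLipSupported

theorem LipSupported.abs_integral_sub_le (hφ : LipSupported A R φ) (hb : VelocityBounds b Λ)
    (hf : IsWeakTransport b f) (hs : 0 ≤ s) (hst : s ≤ t) :
    |(∫ p, φ p ∂(f t : Measure V)) - ∫ p, φ p ∂(f s : Measure V)| ≤ A * (Λ * R) * (t - s) := by
  have hlim : Filter.Tendsto (fun δ : ℝ => A * (Λ * (R + δ)) * (t - s) + 2 * (A * δ))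
      (nhdsWithin 0 (Set.Ioi 0)) (nhds (A * (Λ * R) * (t - s))) :=
    (Continuous.tendsto' (by fun_prop) 0 _ (by simp)).mono_left nhdsWithin_le_nhds
  refine ge_of_tendsto hlim ?_
  filter_upwards [self_mem_nhdsWithin] with δ hδ
  obtain ⟨η, rfl⟩ := exists_contDiffBump_rOut_eq (V := V) hδ
  obtain ⟨B, hB⟩ := exists_smoothLipSupported_mollify η A
  have hsmooth := (hB R φ hφ).abs_integral_sub_le hb hf hs hst
  rw [NNReal.coe_add, Real.coe_toNNReal _ η.rOut_pos.le] at hsmooth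
  have hs' := abs_le.1 (hφ.abs_integral_mollify_sub_le η (f s))
  have ht' := abs_le.1 (hφ.abs_integral_mollify_sub_le η (f t))
  rw [abs_le] at hsmooth ⊢
  constructor <;> linarith

theorem SmoothLipSupported.abs_integral_sub_sub_le (hφ : SmoothLipSupported A B R φ)
    (hb : VelocityBounds b Λ) (hf : IsWeakTransport b f) {h : ℝ} (ht : 0 ≤ t) (hh : 0 ≤ h) :
    |(∫ p, φ p ∂(f (t + h) : Measure V)) - (∫ p, φ p ∂(f t : Measure V)) -
      h * ∫ p, fderiv ℝ φ p (b t p) ∂(f t : Measure V)| ≤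
      (A * Λ + (A * Λ + B * (Λ * R)) * (Λ * R)) * h ^ 2 := by
  have hth : 0 ≤ t + h := add_nonneg ht hh
  have hrate : ∀ r ∈ Set.uIoc t (t + h), ‖(∫ p, fderiv ℝ φ p (b r p) ∂(f r : Measure V)) -
      ∫ p, fderiv ℝ φ p (b t p) ∂(f t : Measure V)‖ ≤
      (A * Λ + (A * Λ + B * (Λ * R)) * (Λ * R)) * h := by
    intro r hr
    rw [Set.uIoc_of_le (le_add_of_nonneg_right hh)] at hr
    have htr : t ≤ r := hr.1.le
    have hfield := hφ.abs_integral_fderiv_sub_le hb (ht.trans htr) ht (f r)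
    have hmeasure := (hφ.lipSupported_fderiv_apply hb ht).abs_integral_sub_le hb hf ht htr
    rw [abs_of_nonneg (sub_nonneg.2 htr)] at hfield
    push_cast at hmeasure
    refine (norm_sub_le_norm_sub_add_norm_sub _
      (∫ p, fderiv ℝ φ p (b t p) ∂(f r : Measure V)) _).trans
        ((add_le_add hfield hmeasure).trans ?_)
    rw [← mul_assoc, ← add_mul]
    gcongr
    linarith [hr.2]
  rw [hφ.integral_sub_eq hb hf ht hth,
    show h * ∫ p, fderiv ℝ φ p (b t p) ∂(f t : Measure V) =
      ∫ _ in t..(t + h), ∫ p, fderiv ℝ φ p (b t p) ∂(f t : Measure V) by simp,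
    ← intervalIntegral.integral_sub (hφ.intervalIntegrable hb hf.cont ht hth)
      intervalIntegrable_const]
  refine (intervalIntegral.norm_integral_le_of_norm_le_const hrate).trans_eq ?_
  rw [add_sub_cancel_left, abs_of_nonneg hh]
  ring

end Transport

section Scheme

variable {V : Type*} [NormedAddCommGroup V] [NormedSpace ℝ V] {b : ℝ → V → V} {c Λ A B R : ℝ≥0}
  {t h : ℝ} {S : V → V} {Φ : ℕ → V → V} {φ : V → ℝ}

/-- `S` approximates the flow of `b` from time `t` to time `t + h` to second order in `h`. -/
structure IsConsistentStep (b : ℝ → V → V) (c : ℝ≥0) (t h : ℝ) (S : V → V) : Prop where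
  lip : ∀ p q, ‖S p - S q‖ ≤ (1 + c * h) * ‖p - q‖
  move : ∀ p, ‖S p - p‖ ≤ c * h * (1 + ‖p‖)
  consistent : ∀ p, ‖S p - p - h • b t p‖ ≤ c * h ^ 2 * (1 + ‖p‖)

/-- The iterates `Φ n` of a one-step scheme of step `h`, started at time `0`, all of whose steps
are consistent with `b`. -/
structure IsConsistentScheme (b : ℝ → V → V) (c : ℝ≥0) (h : ℝ) (Φ : ℕ → V → V) : Prop where
  zero : Φ 0 = id
  succ : ∀ n : ℕ, ∃ S, IsConsistentStep b c (n * h) h S ∧ Φ (n + 1) = S ∘ Φ n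

theorem IsConsistentStep.lipschitzWith (hS : IsConsistentStep b c t h S) (hh : 0 ≤ h) :
    LipschitzWith (Real.exp (2 * c * h)).toNNReal S := by
  refine LipschitzWith.of_dist_le' fun p q => ?_
  rw [dist_eq_norm, dist_eq_norm]
  refine (hS.lip p q).trans (mul_le_mul_of_nonneg_right ?_ (norm_nonneg _))
  have hch : 0 ≤ c * h := mul_nonneg c.coe_nonneg hh
  linarith [Real.add_one_le_exp (2 * c * h)]

theorem IsConsistentStep.one_add_norm_le (hS : IsConsistentStep b c t h S) (hh : 0 ≤ h)
    (hch : c * h ≤ 1 / 2) (p : V) : 1 + ‖p‖ ≤ Real.exp (2 * c * h) * (1 + ‖S p‖) := by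
  have hch0 : 0 ≤ c * h := mul_nonneg c.coe_nonneg hh
  have hmove : (1 - c * h) * (1 + ‖p‖) ≤ 1 + ‖S p‖ := by
    linarith [hS.move p, norm_sub_norm_le p (S p), norm_sub_rev p (S p)]
  have hexp : 1 ≤ Real.exp (2 * c * h) * (1 - c * h) :=
    calc 1 ≤ (2 * c * h + 1) * (1 - c * h) := by nlinarith
      _ ≤ _ := mul_le_mul_of_nonneg_right (Real.add_one_le_exp _) (by linarith)
  calc 1 + ‖p‖ ≤ Real.exp (2 * c * h) * (1 - c * h) * (1 + ‖p‖) :=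
        le_mul_of_one_le_left (by positivity) hexp
    _ ≤ _ := by rw [mul_assoc]; gcongr

theorem IsConsistentStep.lipSupported_comp (hS : IsConsistentStep b c t h S) (hh : 0 ≤ h)
    (hch : c * h ≤ 1 / 2) (hφ : LipSupported A R φ) :
    LipSupported ((Real.exp (2 * c * h)).toNNReal * A) ((Real.exp (2 * c * h)).toNNReal * R)
      (φ ∘ S) :=
  hφ.comp (hS.lipschitzWith hh) fun p => by
    rw [Real.coe_toNNReal _ (Real.exp_nonneg _)]
    exact hS.one_add_norm_le hh hch p

theorem IsConsistentScheme.lipSupported_comp (hΦ : IsConsistentScheme b c h Φ) (hh : 0 ≤ h)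
    (hch : c * h ≤ 1 / 2) (N : ℕ) (hφ : LipSupported A R φ) :
    LipSupported ((Real.exp (2 * c * h)).toNNReal ^ N * A)
      ((Real.exp (2 * c * h)).toNNReal ^ N * R) (φ ∘ Φ N) := by
  induction N generalizing φ A R with
  | zero => simpa only [pow_zero, one_mul, hΦ.zero, Function.comp_id] using hφ
  | succ N ih =>
    obtain ⟨S, hS, hΦN⟩ := hΦ.succ N
    simpa only [hΦN, ← Function.comp_assoc, pow_succ, mul_assoc (_ ^ N)] using
      ih (hS.lipSupported_comp hh hch hφ)

theorem IsConsistentScheme.continuous (hΦ : IsConsistentScheme b c h Φ) (hh : 0 ≤ h) (n : ℕ) :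
    Continuous (Φ n) := by
  induction n with
  | zero => exact hΦ.zero ▸ continuous_id
  | succ n ih =>
    obtain ⟨S, hS, hΦn⟩ := hΦ.succ n
    exact hΦn ▸ (hS.lipschitzWith hh).continuous.comp ih

variable [FiniteDimensional ℝ V] [MeasurableSpace V] [BorelSpace V] {f : ℝ → ProbabilityMeasure V}
  {η : ContDiffBump (0 : V)}

theorem IsConsistentStep.abs_mollify_comp_sub_sub_le (hS : IsConsistentStep b c t h S)
    (hb : VelocityBounds b Λ) (ht : 0 ≤ t) (hh : 0 ≤ h) (hφ : LipschitzWith A φ)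
    (hψ : SmoothLipSupported A B R (mollify η φ)) (hφS : Continuous (φ ∘ S)) {p : V}
    (hp : 1 + ‖p‖ ≤ R) :
    |mollify η (φ ∘ S) p - mollify η φ p - h * fderiv ℝ (mollify η φ) p (b t p)| ≤
      A * Λ * η.rOut * h + (A * (c * (R + η.rOut)) + B * (Λ * R) ^ 2) * h ^ 2 := by
  have htranslate : |mollify η (φ ∘ S) p - mollify η φ (p + h • b t p)| ≤
      A * (c * h ^ 2 * (R + η.rOut) + h * (Λ * η.rOut)) := by
    refine abs_mollify_sub_mollify_le η hφS hφ.continuous fun q hq => ?_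
    refine (hφ.norm_sub_le _ _).trans (mul_le_mul_of_nonneg_left ?_ A.coe_nonneg)
    calc ‖S (p - q) - (p + h • b t p - q)‖
        = ‖(S (p - q) - (p - q) - h • b t (p - q)) + h • (b t (p - q) - b t p)‖ := by
          congr 1; module
      _ ≤ c * h ^ 2 * (1 + ‖p - q‖) + h * (Λ * ‖q‖) := by
          refine norm_add_le_of_le (hS.consistent _) ?_
          rw [norm_smul_of_nonneg hh]
          refine mul_le_mul_of_nonneg_left (((hb.space t ht).norm_sub_le _ _).trans_eq ?_) hh
          rw [sub_sub_cancel_left, norm_neg]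
      _ ≤ _ := by
          gcongr ?_ * ?_ + h * (Λ * ?_)
          linarith [norm_sub_le p q]
  have htaylor := hψ.abs_sub_sub_fderiv_le p (h • b t p)
  rw [map_smul, smul_eq_mul] at htaylor
  have hfield : B * ‖h • b t p‖ ^ 2 ≤ B * (h * (Λ * R)) ^ 2 := by
    rw [norm_smul_of_nonneg hh]
    gcongr
    exact hb.norm_le ht hp
  calc _ = |(mollify η (φ ∘ S) p - mollify η φ (p + h • b t p)) +
        (mollify η φ (p + h • b t p) - mollify η φ p - h * fderiv ℝ (mollify η φ) p (b t p))| := by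
        congr 1; ring
    _ ≤ A * (c * h ^ 2 * (R + η.rOut) + h * (Λ * η.rOut)) + B * (h * (Λ * R)) ^ 2 :=
        (abs_add_le _ _).trans (add_le_add htranslate (htaylor.trans hfield))
    _ = _ := by ring

end Scheme

section Duality

variable {V : Type*} [NormedAddCommGroup V] [NormedSpace ℝ V] [FiniteDimensional ℝ V]
  [MeasurableSpace V] [BorelSpace V] {b : ℝ → V → V} {c Λ A B R a r : ℝ≥0} {t h T e : ℝ}
  {S : V → V} {Φ : ℕ → V → V} {φ : V → ℝ} {f : ℝ → ProbabilityMeasure V}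
  {η : ContDiffBump (0 : V)}

theorem IsConsistentStep.abs_integral_mollify_comp_sub_sub_le (hS : IsConsistentStep b c t h S)
    (hb : VelocityBounds b Λ) (ht : 0 ≤ t) (hh : 0 ≤ h) (hφ : LipschitzWith A φ)
    (hψ : SmoothLipSupported A B R (mollify η φ)) (hφS : Continuous (φ ∘ S))
    (hψS : LipSupported A R (mollify η (φ ∘ S))) (μ : ProbabilityMeasure V) :
    |(∫ p, mollify η (φ ∘ S) p ∂(μ : Measure V)) - (∫ p, mollify η φ p ∂(μ : Measure V)) -
      h * ∫ p, fderiv ℝ (mollify η φ) p (b t p) ∂(μ : Measure V)| ≤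
      A * Λ * η.rOut * h + (A * (c * (R + η.rOut)) + B * (Λ * R) ^ 2) * h ^ 2 := by
  have hδ := η.rOut_pos.le
  have hdiff : Integrable (fun p => mollify η (φ ∘ S) p - mollify η φ p) (μ : Measure V) :=
    (hψS.integrable _).sub (hψ.integrable _)
  rw [← integral_const_mul, ← integral_sub (hψS.integrable _) (hψ.integrable _),
    ← integral_sub hdiff (((hψ.lipSupported_fderiv_apply hb ht).integrable _).const_mul h)]
  refine abs_integral_le_of_forall_abs_le fun p => ?_
  rcases le_or_gt (1 + ‖p‖) (R : ℝ) with hp | hp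
  · exact hS.abs_mollify_comp_sub_sub_le hb ht hh hφ hψ hφS hp
  · rw [hψ.zero p hp, hψS.zero p hp, hψ.fderiv_eq_zero hp, zero_apply, mul_zero, sub_self, sub_zero,
      abs_zero]
    positivity

theorem exists_abs_integral_mollify_sub_step_le (hb : VelocityBounds b Λ)
    (hf : IsWeakTransport b f) (η : ContDiffBump (0 : V)) (A R c : ℝ≥0) :
    ∃ D : ℝ, ∀ (φ : V → ℝ) (S : V → V) (t h : ℝ), LipSupported A R φ → LipSupported A R (φ ∘ S) →
      0 ≤ t → 0 ≤ h → IsConsistentStep b c t h S →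
      |(∫ p, mollify η φ p ∂(f (t + h) : Measure V)) -
        ∫ p, mollify η (φ ∘ S) p ∂(f t : Measure V)| ≤ A * Λ * η.rOut * h + D * h ^ 2 := by
  obtain ⟨B, hB⟩ := LipSupported.exists_smoothLipSupported_mollify η A
  set ρ := R + η.rOut.toNNReal
  refine ⟨(A * Λ + (A * Λ + B * (Λ * ρ)) * (Λ * ρ)) + (A * (c * (ρ + η.rOut)) + B * (Λ * ρ) ^ 2),
    fun φ S t h hφ hφS ht hh hS => ?_⟩
  have hψ := hB R φ hφ
  have htime := abs_le.1 (hψ.abs_integral_sub_sub_le hb hf ht hh)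
  have hspace := abs_le.1 (hS.abs_integral_mollify_comp_sub_sub_le hb ht hh hφ.lip hψ
    hφS.lip.continuous (hφS.mollify η) (f t))
  rw [abs_le]
  constructor <;> linarith

theorem IsConsistentScheme.abs_integral_mollify_sub_le (hΦ : IsConsistentScheme b c h Φ)
    (hh : 0 ≤ h) (hch : c * h ≤ 1 / 2)
    (hstep : ∀ (φ : V → ℝ) (S : V → V) (t : ℝ), LipSupported A R φ → LipSupported A R (φ ∘ S) →
      0 ≤ t → IsConsistentStep b c t h S →
      |(∫ p, mollify η φ p ∂(f (t + h) : Measure V)) -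
        ∫ p, mollify η (φ ∘ S) p ∂(f t : Measure V)| ≤ e)
    (N : ℕ) (hφ : LipSupported a r φ) (ha : (Real.exp (2 * c * h)).toNNReal ^ N * a ≤ A)
    (hr : (Real.exp (2 * c * h)).toNNReal ^ N * r ≤ R) :
    |(∫ p, mollify η φ p ∂(f (N * h) : Measure V)) -
      ∫ p, mollify η (φ ∘ Φ N) p ∂(f 0 : Measure V)| ≤ N * e := by
  have hκ : 1 ≤ (Real.exp (2 * c * h)).toNNReal :=
    Real.one_le_toNNReal.2 (Real.one_le_exp (by positivity))
  induction N generalizing φ a r with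
  | zero => simp [hΦ.zero]
  | succ N ih =>
    obtain ⟨S, hS, hΦN⟩ := hΦ.succ N
    have hφS := hS.lipSupported_comp hh hch hφ
    rw [pow_succ, mul_assoc] at ha hr
    have haA := (le_mul_of_one_le_left' (one_le_pow₀ hκ)).trans ha
    have hrR := (le_mul_of_one_le_left' (one_le_pow₀ hκ)).trans hr
    have hlast := hstep φ S (N * h)
      (hφ.mono ((le_mul_of_one_le_left' hκ).trans haA) ((le_mul_of_one_le_left' hκ).trans hrR))
      (hφS.mono haA hrR) (by positivity) hS
    rw [hΦN, Nat.cast_succ, add_one_mul, add_one_mul, add_comm (N * e)]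
    exact (abs_sub_le _ _ _).trans (add_le_add hlast (ih hφS ha hr))

theorem LipSupported.exists_abs_integral_sub_comp_scheme_le (hφ : LipSupported a r φ)
    (hb : VelocityBounds b Λ) (hf : IsWeakTransport b f) (c : ℝ≥0) (T : ℝ) :
    ∃ P : ℝ, ∀ δ > 0, ∃ D : ℝ, ∀ (h : ℝ) (N : ℕ) (Φ : ℕ → V → V), 0 ≤ h → c * h ≤ 1 / 2 →
      N * h = T → IsConsistentScheme b c h Φ →
      |(∫ p, φ p ∂(f T : Measure V)) - ∫ p, φ (Φ N p) ∂(f 0 : Measure V)| ≤ P * δ + D * h := by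
  set κ := (Real.exp (2 * c * T)).toNNReal with hκ
  refine ⟨a + κ * a + T * (κ * a * Λ), fun δ hδ => ?_⟩
  obtain ⟨η, rfl⟩ := exists_contDiffBump_rOut_eq (V := V) hδ
  obtain ⟨D, hD⟩ := exists_abs_integral_mollify_sub_step_le hb hf η (κ * a) (κ * r) c
  refine ⟨T * D, fun h N Φ hh hch hT hΦ => ?_⟩
  have hpow : (Real.exp (2 * c * h)).toNNReal ^ N = κ := by
    rw [← Real.toNNReal_pow (Real.exp_nonneg _), ← Real.exp_nat_mul, hκ, ← hT]
    ring_nf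
  have hφΦ := hΦ.lipSupported_comp hh hch N hφ
  rw [hpow] at hφΦ
  have hscheme := hΦ.abs_integral_mollify_sub_le hh hch
    (fun φ S t hφ hφS ht hS => hD φ S t h hφ hφS ht hh hS) N hφ (by rw [hpow]) (by rw [hpow])
  rw [hT] at hscheme
  have hstart := abs_le.1 (hφΦ.abs_integral_mollify_sub_le η (f 0))
  have hend := abs_le.1 (hφ.abs_integral_mollify_sub_le η (f T))
  have hsum : N * ((κ * a : ℝ≥0) * Λ * η.rOut * h + D * h ^ 2) =
      T * (κ * a * Λ) * η.rOut + T * D * h := by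
    rw [← hT]
    push_cast
    ring
  rw [hsum] at hscheme
  push_cast at hstart
  simp only [Function.comp_apply] at hstart
  rw [abs_le] at hscheme ⊢
  constructor <;> linarith

theorem LipSupported.tendsto_integral_comp_scheme {ι : Type*} {l : Filter ι} {h : ι → ℝ}
    {N : ι → ℕ} {Φ : ι → ℕ → V → V} (hφ : LipSupported a r φ) (hb : VelocityBounds b Λ)
    (hf : IsWeakTransport b f) (hlim : Filter.Tendsto h l (nhds 0))
    (hΦ : ∀ᶠ i in l, 0 ≤ h i ∧ N i * h i = T ∧ IsConsistentScheme b c (h i) (Φ i)) :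
    Filter.Tendsto (fun i => ∫ p, φ (Φ i (N i) p) ∂(f 0 : Measure V)) l
      (nhds (∫ p, φ p ∂(f T : Measure V))) := by
  obtain ⟨P, hP⟩ := hφ.exists_abs_integral_sub_comp_scheme_le hb hf c T
  refine Metric.tendsto_nhds.2 fun κ hκ => ?_
  obtain ⟨δ, hδ, hPδ⟩ := exists_pos_mul_lt hκ P
  obtain ⟨D, hD⟩ := hP δ hδ
  have herror : Filter.Tendsto (fun i => P * δ + D * h i) l (nhds (P * δ)) := by
    simpa only [mul_zero, add_zero] using (hlim.const_mul D).const_add (P * δ)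
  have hsmall : Filter.Tendsto (fun i => c * h i) l (nhds 0) := by
    simpa only [mul_zero] using hlim.const_mul (c : ℝ)
  filter_upwards [hΦ, herror.eventually_lt_const hPδ,
    hsmall.eventually_le_const one_half_pos] with i ⟨hh, hN, hΦi⟩ hlt hch
  rw [dist_comm]
  exact (hD (h i) (N i) (Φ i) hh hch hN hΦi).trans_lt hlt

end Duality

section WeakConvergence

variable {V : Type*} [SeminormedAddCommGroup V] {φ : V → ℝ} {A B C : ℝ≥0}

/-- The tent function equal to `1` for `‖p‖ ≤ ρ` and to `0` for `ρ + 1 ≤ ‖p‖`, used to localize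
test functions without compact support. -/
def cutoff (ρ : ℝ≥0) (p : V) : ℝ := max 0 (min 1 (ρ + 1 - ‖p‖))

theorem cutoff_nonneg (ρ : ℝ≥0) (p : V) : 0 ≤ cutoff ρ p := le_max_left _ _

theorem cutoff_le_one (ρ : ℝ≥0) (p : V) : cutoff ρ p ≤ 1 :=
  max_le zero_le_one (min_le_left _ _)

theorem cutoff_eq_one {ρ : ℝ≥0} {p : V} (hp : ‖p‖ ≤ ρ) : cutoff ρ p = 1 := by
  rw [cutoff, min_eq_left (by linarith), max_eq_right zero_le_one]

theorem lipSupported_cutoff (ρ : ℝ≥0) : LipSupported 1 (ρ + 2) (cutoff ρ : V → ℝ) := by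
  refine ⟨?_, fun p hp => max_eq_left ((min_le_right _ _).trans ?_)⟩
  · have htent : LipschitzWith 1 fun p : V => ρ + 1 - ‖p‖ := by
      simpa only [zero_add] using (LipschitzWith.const (ρ + 1 : ℝ)).sub (lipschitzWith_one_norm)
    exact (htent.const_min 1).const_max 0
  · push_cast at hp
    linarith

theorem lipSupported_cutoff_mul (hφ : LipschitzWith A φ) (hB : ∀ p, |φ p| ≤ B) (ρ : ℝ≥0) :
    LipSupported (A + B) (ρ + 2) fun p => cutoff ρ p * φ p := by
  refine ⟨LipschitzWith.of_dist_le_mul fun p q => ?_, fun p hp => ?_⟩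
  · have hcut := (lipSupported_cutoff ρ).lip.norm_sub_le p q
    rw [NNReal.coe_one, one_mul] at hcut
    calc |cutoff ρ p * φ p - cutoff ρ q * φ q|
        = |cutoff ρ p * (φ p - φ q) + (cutoff ρ p - cutoff ρ q) * φ q| := by congr 1; ring
      _ ≤ 1 * (A * ‖p - q‖) + ‖p - q‖ * B := by
        refine (abs_add_le _ _).trans ?_
        rw [abs_mul, abs_mul, abs_of_nonneg (cutoff_nonneg ρ p)]
        gcongr
        exacts [cutoff_le_one ρ p, hφ.norm_sub_le p q, hcut, hB q]
      _ = _ := by rw [dist_eq_norm]; push_cast; ring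
  · rw [(lipSupported_cutoff ρ).zero p hp, zero_mul]

variable [MeasurableSpace V] [OpensMeasurableSpace V]

theorem integrable_cutoff (ρ : ℝ≥0) (μ : ProbabilityMeasure V) :
    Integrable (cutoff ρ) (μ : Measure V) :=
  .of_bound (lipSupported_cutoff ρ).lip.continuous.measurable.aestronglyMeasurable 1
    (.of_forall fun p => (Real.norm_of_nonneg (cutoff_nonneg ρ p)).trans_le (cutoff_le_one ρ p))

theorem tendsto_integral_cutoff (μ : ProbabilityMeasure V) :
    Filter.Tendsto (fun n : ℕ => ∫ p, cutoff n p ∂(μ : Measure V)) Filter.atTop (nhds 1) := by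
  rw [show (1 : ℝ) = ∫ _, 1 ∂(μ : Measure V) by simp]
  refine tendsto_integral_of_dominated_convergence (fun _ => 1)
    (fun n => (integrable_cutoff n μ).aestronglyMeasurable) (integrable_const 1)
    (fun n => .of_forall fun p => (Real.norm_of_nonneg (cutoff_nonneg _ p)).trans_le
      (cutoff_le_one _ p)) (.of_forall fun p => tendsto_const_nhds.congr' ?_)
  filter_upwards [Filter.eventually_ge_atTop ⌈‖p‖⌉₊] with n hn
  exact (cutoff_eq_one ((Nat.le_ceil _).trans (by exact_mod_cast hn))).symm

theorem abs_integral_sub_cutoff_mul_le (hφ : Continuous φ) (hB : ∀ p, |φ p| ≤ B) (ρ : ℝ≥0)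
    (μ : ProbabilityMeasure V) :
    |(∫ p, φ p ∂(μ : Measure V)) - ∫ p, cutoff ρ p * φ p ∂(μ : Measure V)| ≤
      B * (1 - ∫ p, cutoff ρ p ∂(μ : Measure V)) := by
  have hcut := integrable_cutoff ρ μ
  have hint : Integrable φ (μ : Measure V) :=
    .of_bound hφ.measurable.aestronglyMeasurable B (.of_forall hB)
  have hmul : Integrable (fun p => cutoff ρ p * φ p) (μ : Measure V) :=
    hcut.mul_bdd hφ.measurable.aestronglyMeasurable (.of_forall hB)
  have hmass : ∫ p, B * (1 - cutoff ρ p) ∂(μ : Measure V) =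
      B * (1 - ∫ p, cutoff ρ p ∂(μ : Measure V)) := by
    rw [integral_const_mul, integral_sub (integrable_const _) hcut, integral_const,
      probReal_univ, one_smul]
  rw [← integral_sub hint hmul, ← hmass]
  refine norm_integral_le_of_norm_le (G := ℝ) (((integrable_const _).sub hcut).const_mul B)
    (.of_forall fun p => ?_)
  have hcut_le := sub_nonneg.2 (cutoff_le_one ρ p)
  rw [← one_sub_mul, norm_mul, Real.norm_of_nonneg hcut_le, mul_comm]
  exact mul_le_mul_of_nonneg_right (hB p) hcut_le

-- No mass escapes to infinity: testing against `cutoff ρ` itself controls the tails of `μ i`.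
theorem tendsto_of_forall_lipSupported {ι : Type*} {l : Filter ι} [l.IsCountablyGenerated]
    {μ : ι → ProbabilityMeasure V} {ν : ProbabilityMeasure V}
    (h : ∀ (A R : ℝ≥0) (φ : V → ℝ), LipSupported A R φ →
      Filter.Tendsto (fun i => ∫ p, φ p ∂(μ i : Measure V)) l (nhds (∫ p, φ p ∂(ν : Measure V)))) :
    Filter.Tendsto μ l (nhds ν) := by
  rw [tendsto_iff_forall_lipschitz_integral_tendsto]
  rintro φ ⟨D, hD⟩ ⟨A, hA⟩
  set B : ℝ≥0 := (|φ 0| + D).toNNReal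
  have hB : ∀ p, |φ p| ≤ B := fun p => by
    refine le_trans ?_ (Real.le_coe_toNNReal _)
    linarith [abs_sub_abs_le_abs_sub (φ p) (φ 0), hD p 0, Real.dist_eq (φ p) (φ 0)]
  refine Metric.tendsto_nhds.2 fun κ hκ => ?_
  have htail : Filter.Tendsto (fun n : ℕ => 2 * (B * (1 - ∫ p, cutoff n p ∂(ν : Measure V))))
      Filter.atTop (nhds 0) := by
    simpa only [sub_self, mul_zero] using
      (((tendsto_integral_cutoff ν).const_sub 1).const_mul (B : ℝ)).const_mul 2
  obtain ⟨n, hn⟩ := (htail.eventually_lt_const hκ).exists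
  have hcut := ((h _ _ _ (lipSupported_cutoff n)).const_sub 1).const_mul (B : ℝ)
  have hmul := ((h _ _ _ (lipSupported_cutoff_mul hA hB n)).sub_const
    (∫ p, cutoff n p * φ p ∂(ν : Measure V))).abs
  have herror := (hcut.add hmul).add_const (B * (1 - ∫ p, cutoff n p ∂(ν : Measure V)))
  rw [sub_self, abs_zero, add_zero, ← two_mul] at herror
  filter_upwards [herror.eventually_lt_const hn] with i hi
  refine lt_of_le_of_lt ?_ hi
  have hstart := abs_integral_sub_cutoff_mul_le hA.continuous hB n (μ i)
  have hend := abs_integral_sub_cutoff_mul_le hA.continuous hB n ν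
  rw [abs_sub_comm] at hend
  exact (dist_triangle4 _ _ _ _).trans (add_le_add_three hstart le_rfl hend)

end WeakConvergence

theorem IsWeakTransport.tendsto_map_scheme {V : Type*} [NormedAddCommGroup V] [NormedSpace ℝ V]
    [FiniteDimensional ℝ V] [MeasurableSpace V] [BorelSpace V] {b : ℝ → V → V} {c Λ : ℝ≥0} {T : ℝ}
    {f : ℝ → ProbabilityMeasure V} {ι : Type*} {l : Filter ι} [l.IsCountablyGenerated]
    {h : ι → ℝ} {N : ι → ℕ} {Φ : ι → ℕ → V → V} (hf : IsWeakTransport b f)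
    (hb : VelocityBounds b Λ) (hlim : Filter.Tendsto h l (nhds 0))
    (hΦ : ∀ᶠ i in l, 0 ≤ h i ∧ N i * h i = T ∧ IsConsistentScheme b c (h i) (Φ i))
    (hmeas : ∀ i, AEMeasurable (Φ i (N i)) (f 0 : Measure V)) :
    Filter.Tendsto (fun i => (f 0).map (hmeas i)) l (nhds (f T)) :=
  tendsto_of_forall_lipSupported fun _ _ _ hφ =>
    (hφ.tendsto_integral_comp_scheme hb hf hlim hΦ).congr fun i =>
      (integral_map (hmeas i) hφ.lip.continuous.measurable.aestronglyMeasurable).symm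

/-- The velocity field of the characteristics on phase space, for which the Vlasov equation is the
continuity equation `∂_t f + div (b f) = 0`. -/
noncomputable def phaseField (ε : ℝ) (E : ℝ → Plane → Plane) (t : ℝ) (p : Phase) : Phase :=
  ε⁻¹ • (p.2, E t p.1 - ε⁻¹ • perp p.2)

theorem lipschitzWith_perp : LipschitzWith 1 perp :=
  LipschitzWith.of_dist_le_mul fun v w => by
    rw [dist_eq_norm, dist_eq_norm, ← perp_sub, norm_perp, NNReal.coe_one, one_mul]

theorem IsVlasovSolution.isWeakTransport {ε : ℝ} {E : ℝ → Plane → Plane}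
    {f₀ : ProbabilityMeasure Phase} {f : ℝ → ProbabilityMeasure Phase}
    (hf : IsVlasovSolution ε E f₀ f) (hε : ε ≠ 0) : IsWeakTransport (phaseField ε E) f := by
  obtain ⟨hinit, hcont, hweak⟩ := hf
  refine ⟨hcont, fun φ hφ hsupp t ht => ?_⟩
  simp only [phaseField, map_smul, smul_eq_mul, integral_const_mul,
    intervalIntegral.integral_const_mul]
  rw [hinit, ← hweak φ hφ hsupp t ht, inv_mul_cancel_left₀ hε]

theorem VelocityBounds.isConsistentStep {V : Type*} [NormedAddCommGroup V] [NormedSpace ℝ V]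
    {b : ℝ → V → V} {Λ A : ℝ≥0} {t h : ℝ} {S G : V → V} (hb : VelocityBounds b Λ) (ht : 0 ≤ t)
    (hh : 0 ≤ h) (hS : ∀ p, S p = p + h • b t (G p)) (hG : LipschitzWith A G)
    (hgrowth : ∀ p, 1 + ‖G p‖ ≤ A * (1 + ‖p‖)) (hclose : ∀ p, ‖G p - p‖ ≤ ‖S p - p‖) :
    IsConsistentStep b (Λ * A + Λ * (Λ * A)) t h S := by
  have hmove : ∀ p, ‖S p - p‖ ≤ Λ * A * h * (1 + ‖p‖) := fun p => by
    rw [hS, add_sub_cancel_left, norm_smul_of_nonneg hh]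
    calc h * ‖b t (G p)‖ ≤ h * (Λ * (A * (1 + ‖p‖))) := by
          gcongr
          exact (hb.growth t ht _).trans (by gcongr; exact hgrowth p)
      _ = _ := by ring
  refine ⟨fun p q => ?_, fun p => (hmove p).trans ?_, fun p => ?_⟩
  · calc ‖S p - S q‖ = ‖(p - q) + h • (b t (G p) - b t (G q))‖ := by
          rw [hS, hS]; congr 1; module
      _ ≤ ‖p - q‖ + h * (Λ * (A * ‖p - q‖)) := by
          refine norm_add_le_of_le le_rfl ?_
          rw [norm_smul_of_nonneg hh]
          gcongr
          exact ((hb.space t ht).norm_sub_le _ _).trans (by gcongr; exact hG.norm_sub_le p q)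
      _ = (1 + (Λ * A : ℝ≥0) * h) * ‖p - q‖ := by push_cast; ring
      _ ≤ _ := by gcongr; exact le_self_add
  · push_cast
    gcongr
    exact le_add_of_nonneg_right (by positivity)
  · calc ‖S p - p - h • b t p‖ = h * ‖b t (G p) - b t p‖ := by
          rw [hS, add_sub_cancel_left, ← smul_sub, norm_smul_of_nonneg hh]
      _ ≤ h * (Λ * (Λ * A * h * (1 + ‖p‖))) := by
          gcongr
          refine ((hb.space t ht).norm_sub_le _ _).trans ?_
          gcongr
          exact (hclose p).trans (hmove p)
      _ = (Λ * (Λ * A) : ℝ≥0) * h ^ 2 * (1 + ‖p‖) := by push_cast; ring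
      _ ≤ _ := by gcongr; exact le_add_self

section FieldBounds

variable {E : ℝ → Plane → Plane} {K L M Λ κ : ℝ≥0} {ε h t : ℝ}

theorem FieldBounds.norm_phaseField_le (hb : FieldBounds E K L M) (ε : ℝ) (ht : 0 ≤ t)
    (p : Phase) : ‖phaseField ε E t p‖ ≤ ‖ε⁻¹‖ * (1 + M + ‖ε⁻¹‖) * (1 + ‖p‖) := by
  have hfield : ‖E t p.1 - ε⁻¹ • perp p.2‖ ≤ M + ‖ε⁻¹‖ * ‖p.2‖ := by
    refine norm_sub_le_of_le (hb.size t ht _) ?_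
    rw [norm_smul, norm_perp]
  have hsnd : ‖p.2‖ ≤ ‖p‖ := norm_snd_le p
  rw [phaseField, norm_smul, mul_assoc]
  gcongr
  calc max ‖p.2‖ ‖E t p.1 - ε⁻¹ • perp p.2‖ ≤ ‖p‖ + (M + ‖ε⁻¹‖ * ‖p‖) :=
        max_le (hsnd.trans (le_add_of_nonneg_right (by positivity)))
          ((hfield.trans (by gcongr)).trans (le_add_of_nonneg_left (norm_nonneg p)))
    _ ≤ _ := by nlinarith [norm_nonneg p, norm_nonneg ε⁻¹, mul_nonneg M.coe_nonneg (norm_nonneg p)]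

theorem FieldBounds.exists_velocityBounds (hb : FieldBounds E K L M) (ε : ℝ) :
    ∃ Λ, VelocityBounds (phaseField ε E) Λ := by
  set κ := ‖ε⁻¹‖₊
  set S := κ * max 1 (K * 1 + κ * (1 * 1))
  set T := κ * max 0 (L + 0)
  have hspace : ∀ t, 0 ≤ t → LipschitzWith S (phaseField ε E t) := fun t ht =>
    (lipschitzWith_smul _).comp (LipschitzWith.prod_snd.prodMk
      (((hb.space t ht).comp LipschitzWith.prod_fst).sub
        ((lipschitzWith_smul _).comp (lipschitzWith_perp.comp LipschitzWith.prod_snd))))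
  have htime : ∀ p, LipschitzOnWith T (fun t => phaseField ε E t p) (Set.Ici 0) := fun p =>
    (lipschitzWith_smul _).comp_lipschitzOnWith ((LipschitzWith.const p.2).lipschitzOnWith.prodMk
      ((hb.time p.1).sub (LipschitzWith.const (ε⁻¹ • perp p.2)).lipschitzOnWith))
  refine ⟨S + T + κ * (1 + M + κ), fun t ht => (hspace t ht).weaken ?_,
    fun p => (htime p).weaken ?_, fun t ht p => (hb.norm_phaseField_le ε ht p).trans ?_⟩
  · exact le_self_add.trans le_self_add
  · exact le_add_self.trans le_self_add
  · gcongr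
    exact (NNReal.coe_le_coe.2 (le_add_self : κ * (1 + M + κ) ≤ S + T + κ * (1 + M + κ)))

theorem FieldBounds.lipschitzWith_velocityUpdate (hb : FieldBounds E K L M) (hε : 0 < ε)
    (hh : 0 ≤ h) (ht : 0 ≤ t) :
    LipschitzWith (1 + (h / ε).toNNReal * K) (velocityUpdate ε h E t) := by
  refine LipschitzWith.of_dist_le_mul fun p q => ?_
  rw [dist_eq_norm, dist_eq_norm]
  refine (norm_le_norm_add_smul_perp (h / ε ^ 2) _).trans ?_
  have hp := velocityUpdate_add_smul_perp ε h E t p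
  have hq := velocityUpdate_add_smul_perp ε h E t q
  calc _ = ‖(p.2 - q.2) + (h / ε) • (E t p.1 - E t q.1)‖ := by
        rw [perp_sub]; congr 1
        linear_combination (norm := module) hp - hq
    _ ≤ ‖p - q‖ + h / ε * (K * ‖p - q‖) := by
      refine norm_add_le_of_le (norm_snd_le (p - q)) ?_
      rw [norm_smul_of_nonneg (by positivity)]
      gcongr
      exact ((hb.space t ht).norm_sub_le _ _).trans (by gcongr; exact norm_fst_le (p - q))
    _ = _ := by
      push_cast
      rw [Real.coe_toNNReal _ (by positivity)]
      ring

theorem FieldBounds.norm_velocityUpdate_le (hb : FieldBounds E K L M) (hε : 0 < ε) (hh : 0 ≤ h)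
    (ht : 0 ≤ t) (p : Phase) : ‖velocityUpdate ε h E t p‖ ≤ ‖p.2‖ + h / ε * M := by
  refine (norm_le_norm_add_smul_perp (h / ε ^ 2) _).trans ?_
  rw [velocityUpdate_add_smul_perp]
  refine norm_add_le_of_le le_rfl ?_
  rw [norm_smul_of_nonneg (by positivity)]
  gcongr
  exact hb.size t ht _

theorem schemeStep_eq_add_smul_phaseField (ε h : ℝ) (E : ℝ → Plane → Plane) (t : ℝ) (p : Phase) :
    schemeStep ε h E t p = p + h • phaseField ε E t (p.1, velocityUpdate ε h E t p) := by
  have hvel := velocityUpdate_add_smul_perp ε h E t p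
  rw [div_eq_mul_inv, div_eq_mul_inv, ← inv_pow] at hvel
  ext1
  · simp only [schemeStep, phaseField, Prod.fst_add, Prod.smul_fst, smul_smul, div_eq_mul_inv]
  · simp only [schemeStep, phaseField, Prod.snd_add, Prod.smul_snd]
    linear_combination (norm := module) hvel

theorem FieldBounds.isConsistentStep_schemeStep (hb : FieldBounds E K L M)
    (hΛ : VelocityBounds (phaseField ε E) Λ) (hε : 0 < ε) (hh : 0 ≤ h) (ht : 0 ≤ t)
    (hκ : h / ε ≤ κ) :
    IsConsistentStep (phaseField ε E)
      (Λ * (1 + κ * (K + M)) + Λ * (Λ * (1 + κ * (K + M)))) t h (schemeStep ε h E t) := by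
  refine hΛ.isConsistentStep ht hh (schemeStep_eq_add_smul_phaseField ε h E t) ?_ (fun p => ?_)
    (fun p => ?_)
  · have hvel := (hb.lipschitzWith_velocityUpdate hε hh ht).weaken (K' := 1 + κ * (K + M)) <| by
      gcongr
      exacts [Real.toNNReal_le_iff_le_coe.2 hκ, le_self_add]
    exact (LipschitzWith.prod_fst.prodMk hvel).weaken (max_le le_self_add le_rfl)
  · have hvel : ‖velocityUpdate ε h E t p‖ ≤ ‖p‖ + κ * M :=
      (hb.norm_velocityUpdate_le hε hh ht p).trans (by gcongr; exact norm_snd_le p)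
    calc 1 + max ‖p.1‖ ‖velocityUpdate ε h E t p‖ ≤ 1 + (‖p‖ + κ * M) := by
          gcongr
          exact max_le ((norm_fst_le p).trans (le_add_of_nonneg_right (by positivity))) hvel
      _ = 1 + ‖p‖ + κ * (0 + M) * (1 + 0) := by ring
      _ ≤ 1 + ‖p‖ + κ * (K + M) * (1 + ‖p‖) := by gcongr <;> positivity
      _ = _ := by push_cast; ring
  · refine max_le ?_ (norm_snd_le (schemeStep ε h E t p - p))
    simp

theorem FieldBounds.exists_isConsistentScheme_discreteFlow (hb : FieldBounds E K L M) (hε : 0 < ε)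
    (Δt : ℝ) :
    ∃ c, ∀ h, 0 ≤ h → h ≤ Δt → IsConsistentScheme (phaseField ε E) c h (discreteFlow ε h E) := by
  obtain ⟨Λ, hΛ⟩ := hb.exists_velocityBounds ε
  refine ⟨_, fun h hh hle => ⟨rfl, fun n => ⟨schemeStep ε h E (n * h),
    hb.isConsistentStep_schemeStep (κ := (Δt / ε).toNNReal) hΛ hε hh (by positivity) ?_, rfl⟩⟩⟩
  exact (Real.le_coe_toNNReal _).trans' (by gcongr)

theorem FieldBounds.continuous_discreteFlow (hb : FieldBounds E K L M) (hε : 0 < ε) (hh : 0 ≤ h)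
    (n : ℕ) : Continuous (discreteFlow ε h E n) := by
  obtain ⟨c, hc⟩ := hb.exists_isConsistentScheme_discreteFlow hε h
  exact (hc h hh le_rfl).continuous hh n

end FieldBounds

section WeakSeminorm

variable {μ : Measure Plane}

theorem wNegDist_map_le {Ω : Type*} [MeasurableSpace Ω] {P : Measure Ω} [IsFiniteMeasure P]
    {X Y : Ω → Plane} {g : Ω → ℝ} (hX : AEMeasurable X P) (hY : AEMeasurable Y P)
    (hg : Integrable g P) (hXY : ∀ a, ‖X a - Y a‖ ≤ g a) :
    wNegDist (P.map X) (P.map Y) ≤ ENNReal.ofReal (∫ a, g a ∂P) := by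
  refine iSup_le fun ⟨φ, hφ⟩ => ENNReal.ofReal_le_ofReal ?_
  obtain ⟨B, hB⟩ := hφ.1
  have hφm := hφ.lipschitzWith.continuous.measurable
  have hint : ∀ Z : Ω → Plane, AEMeasurable Z P → Integrable (fun a => φ (Z a)) P := fun Z hZ =>
    .of_bound (hφm.comp_aemeasurable hZ).aestronglyMeasurable B (.of_forall fun a => hB (Z a))
  rw [integral_map hX hφm.aestronglyMeasurable, integral_map hY hφm.aestronglyMeasurable,
    ← integral_sub (hint X hX) (hint Y hY)]
  refine norm_integral_le_of_norm_le (G := ℝ) hg (.of_forall fun a => ?_)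
  refine (hφ.lipschitzWith.norm_sub_le _ _).trans ?_
  rw [NNReal.coe_one, one_mul]
  exact hXY a

theorem wNegDist_le_of_tendsto {ι : Type*} {l : Filter ι} [l.NeBot]
    {ν : ι → ProbabilityMeasure Plane} {ν' : ProbabilityMeasure Plane} {c : ℝ≥0∞}
    (hν : Filter.Tendsto ν l (nhds ν')) (hle : ∀ᶠ i in l, wNegDist μ (ν i : Measure Plane) ≤ c) :
    wNegDist μ (ν' : Measure Plane) ≤ c := by
  refine iSup_le fun φ => ?_
  obtain ⟨B, hB⟩ := φ.2.1
  have hφ := ProbabilityMeasure.tendsto_iff_forall_integral_tendsto.1 hν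
    (BoundedContinuousFunction.ofNormedAddCommGroup φ.1 φ.2.lipschitzWith.continuous B hB)
  refine le_of_tendsto (ENNReal.continuous_ofReal.tendsto _ |>.comp (hφ.const_sub _).abs) ?_
  filter_upwards [hle] with i hi
  exact (le_iSup (fun ψ : {ψ : Plane → ℝ // IsTestFunction ψ} =>
    ENNReal.ofReal |(∫ x, ψ.1 x ∂μ) - ∫ x, ψ.1 x ∂(ν i : Measure Plane)|) φ).trans hi

end WeakSeminorm

section Density

variable {E : ℝ → Plane → Plane} {K L M : ℝ≥0} {ε Δt : ℝ} {f₀ : ProbabilityMeasure Phase}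
  {f : ℝ → ProbabilityMeasure Phase}

theorem IsVlasovSolution.tendsto_map_discreteFlow (hf : IsVlasovSolution ε E f₀ f)
    (hb : FieldBounds E K L M) (hε : 0 < ε) (hΔt : 0 ≤ Δt) (n : ℕ)
    (hmeas : ∀ m : ℕ, AEMeasurable (discreteFlow ε (Δt / m) E (n * m)) (f₀ : Measure Phase)) :
    Filter.Tendsto (fun m => f₀.map (hmeas m)) Filter.atTop (nhds (f (n * Δt))) := by
  obtain ⟨Λ, hΛ⟩ := hb.exists_velocityBounds ε
  obtain ⟨c, hc⟩ := hb.exists_isConsistentScheme_discreteFlow hε Δt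
  obtain rfl := hf.1
  refine (hf.isWeakTransport hε.ne').tendsto_map_scheme hΛ (c := c)
    (h := fun m : ℕ => Δt / m) (N := fun m => n * m) (Φ := fun m => discreteFlow ε (Δt / m) E)
    (tendsto_const_div_atTop_nhds_zero_nat Δt) ?_ hmeas
  filter_upwards [Filter.eventually_ne_atTop 0] with m hm
  refine ⟨by positivity, by push_cast; field_simp, hc _ (by positivity) (div_le_self hΔt ?_)⟩
  exact_mod_cast Nat.one_le_iff_ne_zero.2 hm

theorem wNegDist_discreteDensity_chargeDensity_le (hb : FieldBounds E K L M) (hε : 0 < ε)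
    (hΔt : 0 ≤ Δt) (hf : IsVlasovSolution ε E f₀ f) (n : ℕ) {g : Phase → ℝ}
    (hg : Integrable g (f₀ : Measure Phase))
    (hflow : ∀ m : ℕ, m ≠ 0 → ∀ p, ‖(discreteFlow ε Δt E n p).1 -
      (discreteFlow ε (Δt / m) E (n * m) p).1‖ ≤ g p) :
    wNegDist (discreteDensity ε Δt E (f₀ : Measure Phase) n)
        (chargeDensity (f (n * Δt) : Measure Phase)) ≤
      ENNReal.ofReal (∫ p, g p ∂(f₀ : Measure Phase)) := by
  have hcont := fun m : ℕ => hb.continuous_discreteFlow hε (h := Δt / m) (by positivity) (n * m)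
  have hlim := ProbabilityMeasure.tendsto_map_of_tendsto_of_continuous _ _
    (hf.tendsto_map_discreteFlow hb hε hΔt n fun m => (hcont m).measurable.aemeasurable)
    continuous_fst
  refine wNegDist_le_of_tendsto hlim ?_
  filter_upwards [Filter.eventually_ne_atTop 0] with m hm
  rw [ProbabilityMeasure.toMeasure_map, ProbabilityMeasure.toMeasure_map,
    Measure.map_map measurable_fst (hcont m).measurable]
  exact wNegDist_map_le
    (continuous_fst.comp (hb.continuous_discreteFlow hε hΔt n)).measurable.aemeasurable
    (continuous_fst.comp (hcont m)).measurable.aemeasurable hg (hflow m hm)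

end Density

end GyroVlasov

theorem corollary3p3_general (E : ℝ → GyroVlasov.Plane → GyroVlasov.Plane)
    (hE : GyroVlasov.IsLipschitzField E) :
    ∃ C : ℝ, 0 < C ∧
      ∀ (f₀ : ProbabilityMeasure GyroVlasov.Phase),
        Integrable (fun p : GyroVlasov.Phase => ‖p.2‖) (f₀ : Measure GyroVlasov.Phase) →
      ∀ (ε Δt : ℝ), 0 < ε → 0 < Δt →
      ∀ (f : ℝ → ProbabilityMeasure GyroVlasov.Phase), GyroVlasov.IsVlasovSolution ε E f₀ f →
      ∀ n : ℕ,
        GyroVlasov.wNegDist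
            (GyroVlasov.discreteDensity ε Δt E (f₀ : Measure GyroVlasov.Phase) n)
            (GyroVlasov.chargeDensity (f (n * Δt) : Measure GyroVlasov.Phase)) ≤
          ENNReal.ofReal
            (C * min (Δt / ε ^ 3 * (1 + ε ^ 2)) (Δt + ε) *
              Real.exp (2 * GyroVlasov.lipX E * (n * Δt)) * (1 + (n * Δt) ^ 2) *
              ∫ p, (1 + ε + ‖p.2‖) ∂(f₀ : Measure GyroVlasov.Phase)) := by
  obtain ⟨L, M, hb⟩ := hE.exists_fieldBounds
  obtain ⟨C, hC, hflow⟩ := hb.exists_norm_discreteFlow_refinement_sub_le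
  rw [Real.coe_toNNReal (GyroVlasov.lipX E) ENNReal.toReal_nonneg] at hflow
  refine ⟨C, hC, fun f₀ hmoment ε Δt hε hΔt f hf n => ?_⟩
  rw [← integral_const_mul]
  exact GyroVlasov.wNegDist_discreteDensity_chargeDensity_le hb hε hΔt.le hf n
    (((integrable_const _).add hmoment).const_mul _) fun m hm p => hflow ε Δt hε hΔt.le m hm n p

theorem corollary3p3 (E : ℝ → GyroVlasov.Plane → GyroVlasov.Plane)
    (hE : GyroVlasov.IsLipschitzField E) :
    ∃ C : ℝ, 0 < C ∧
      ∀ (f₀ : ProbabilityMeasure GyroVlasov.Phase),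
        Integrable (fun p : GyroVlasov.Phase => ‖p‖) (f₀ : Measure GyroVlasov.Phase) →
      ∀ (ε Δt : ℝ), 0 < ε → 0 < Δt →
      ∀ (f : ℝ → ProbabilityMeasure GyroVlasov.Phase), GyroVlasov.IsVlasovSolution ε E f₀ f →
      ∀ n : ℕ,
        GyroVlasov.wNegDist
            (GyroVlasov.discreteDensity ε Δt E (f₀ : Measure GyroVlasov.Phase) n)
            (GyroVlasov.chargeDensity (f (n * Δt) : Measure GyroVlasov.Phase)) ≤
          ENNReal.ofReal
            (C * min (Δt / ε ^ 3 * (1 + ε ^ 2)) (Δt + ε) *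
              Real.exp (2 * GyroVlasov.lipX E * (n * Δt)) * (1 + (n * Δt) ^ 2) *
              ∫ p, (1 + ε + ‖p.2‖) ∂(f₀ : Measure GyroVlasov.Phase)) := by
  obtain ⟨C, hC, hbound⟩ := corollary3p3_general E hE
  exact ⟨C, hC, fun f₀ hmoment => hbound f₀ (hmoment.mono' (by fun_prop)
    (.of_forall fun p => (norm_norm _).trans_le (norm_snd_le p)))⟩
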